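/- Let $\mathcal G(\boldsymbol W,\boldsymbol U)$ be a finite hidden-variable DAG with observed vertices $\boldsymbol W$, each taking values in a finite set, and unobserved vertices $\boldsymbol U$ with arbitrary state spaces. Assume: (1) no $U_i$ has a parent; (2) each $U_i$ has at least two observed children and, for $i\neq j$, the set of observed children of $U_i$ is not contained in that of $U_j$. The districts are the classes of the partition of $\boldsymbol W$ into sets that stay connected after all edges not originating from $\boldsymbol U$ are removed. The c-degree of a district is the maximum of $1$ and the number of $U_i$ that are parents of some member of it, and the c-degree of $\mathcal G$ is the maximum over its districts; assume that it is $1$. The marginal model $\mathcal M(\mathcal G)$ is the set of all distributions of $\boldsymbol W$ that arise from a nonparametric structural equations model over $\mathcal G$ (each variable is a measurable function of its parents and its own error, with independent errors). Fix a topological order of $\boldsymbol W$. For a district $D$, put $\boldsymbol W_1=D$, $\boldsymbol W_2=\mathrm{Pa}_{\mathrm{obs}}(D)\setminus D$ and $$P^*(\boldsymbol W_1=w_1\mid \boldsymbol W_2=w_2)=\prod_{W_i\in D}P(W_i=w_i\mid W_{A_i}=w_{A_i}),$$ where $A_i$ is the set of members of $D\cup\mathrm{Pa}_{\mathrm{obs}}(D)$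 that precede $W_i$. Let $\boldsymbol B$ be the 0-1 matrix with rows indexed by the values $(w_1,w_2)$ and columns indexed by the families $b=(b_i)_{W_i\in D}$ of response functions (maps from values of $\mathrm{Pa}_{\mathrm{obs}}(W_i)$ to values of $W_i$), whose entry is $1$ exactly if $b_i$ maps the parent values in $(w_1,w_2)$ to $w_i$ for all $W_i\in D$. Let $\mathcal P_D=\{\boldsymbol B\boldsymbol r:\boldsymbol r\ge 0,\ \mathbf 1^\top\boldsymbol r=1\}$. An H-representation of $\mathcal P_D$ is a system $H_i\boldsymbol p\le b_i$, $H_e\boldsymbol p=b_e$ of finitely many linear inequalities and equations with rational coefficients whose real solution set is $\mathcal P_D$. Then every $\mathcal P_D$ has an H-representation. Moreover, for every choice of one H-representation for each district, $\mathcal M(\mathcal G)$ is exactly the set of probability distributions $P$ of $\boldsymbol W$ such that (i) $W_A$ and $W_B$ are conditionally independent given $W_C$ under $P$ for all pairwise disjoint $A,B,C\subseteq\boldsymbol W$ for which $C$ d-separates $A$ and $B$ in $\mathcal G$; and (ii) for each district $D$, the vector $\boldsymbol p=[P^*(\boldsymbol W_1=w_1\mid\boldsymbol W_2=w_2)]_{w_1,w_2}$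 satisfies the H-representation of $\mathcal P_D$, for some version of the conditional distributions in the product (that is, for some choice of probability distributions for those conditional distributions whose conditioning event has probability zero; if $P$ is strictly positive, there is nothing to choose). -/

import Mathlib

open MeasureTheory ProbabilityTheory

universe uW uU uS v

/-- A hidden-variable directed acyclic graph with observed vertices `W` and unobserved
vertices `U`. -/
structure HiddenDAG (W : Type uW) (U : Type uU) where
  /-- `Edge x y` means `x → y`. -/
  Edge : W ⊕ U → W ⊕ U → Prop
  acyclic : ∀ x, ¬ Relation.TransGen Edge x x

namespace HiddenDAG

variable {W : Type uW} {U : Type uU} (G : HiddenDAG W U)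

/-! ### Graph notions -/

/-- The observed parents of a vertex. -/
def obsPa (x : W ⊕ U) : Set W := {j | G.Edge (Sum.inl j) x}

/-- The unobserved parents of a vertex. -/
def latPa (x : W ⊕ U) : Set U := {u | G.Edge (Sum.inr u) x}

/-- The observed parents of a set of observed vertices (union over the set). -/
def obsPaSet (A : Set W) : Set W := {j | ∃ i ∈ A, j ∈ G.obsPa (Sum.inl i)}

/-- The observed children of an unobserved vertex. -/
def obsCh (u : U) : Set W := {i | G.Edge (Sum.inr u) (Sum.inl i)}

/-- All unobserved variables are exogenous. -/
def LatentsExogenous : Prop := ∀ (u : U) (x : W ⊕ U), ¬ G.Edge x (Sum.inr u)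

/-- Every unobserved variable has at least two observed children, and its set of observed
children is not contained in that of another unobserved variable. -/
def LatentsReduced : Prop :=
  (∀ u, 2 ≤ (G.obsCh u).ncard) ∧ ∀ u u', u ≠ u' → ¬ G.obsCh u ⊆ G.obsCh u'

/-- The undirected graph that is left after removing all edges that do not originate from
an unobserved variable. -/
def latentGraph : SimpleGraph (W ⊕ U) :=
  SimpleGraph.fromRel fun x y => (∃ u, x = Sum.inr u) ∧ G.Edge x y

/-- The district of an observed vertex. -/
def districtOf (i : W) : Set W :=
  {j | G.latentGraph.Reachable (Sum.inl i) (Sum.inl j)}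

/-- The set of districts. -/
def districts : Set (Set W) := Set.range G.districtOf

/-- The c-degree of a district. -/
noncomputable def districtCDegree (D : Set W) : ℕ :=
  max 1 {u | ∃ i ∈ D, u ∈ G.latPa (Sum.inl i)}.ncard

/-- The c-degree of the graph: the maximum of the c-degrees of its districts. -/
noncomputable def cDegree : ℕ := sSup (G.districtCDegree '' G.districts)

/-! ### d-separation -/

/-- `x` and `y` are joined by an edge, in either direction. -/
def Adj (x y : W ⊕ U) : Prop := G.Edge x y ∨ G.Edge y x

/-- `y` is a collider on `x, y, z`. -/
def Collider (x y z : W ⊕ U) : Prop := G.Edge x y ∧ G.Edge z y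

/-- The ancestors of a set of vertices, the set itself included. -/
def ancestors (C : Set (W ⊕ U)) : Set (W ⊕ U) :=
  {x | ∃ c ∈ C, Relation.ReflTransGen G.Edge x c}

/-- There is a trail from `x` to `y` that is active given `C`: each collider on it is in `C` or
has a descendant in `C`, and no other inner vertex is in `C`. (Whether trails may revisit
vertices makes no difference to the existence of an active one.) -/
def ActiveTrail (C : Set (W ⊕ U)) (x y : W ⊕ U) : Prop :=
  ∃ (n : ℕ) (p : ℕ → W ⊕ U), p 0 = x ∧ p n = y ∧
    (∀ k, k < n → G.Adj (p k) (p (k + 1))) ∧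
    ∀ k, k + 1 < n →
      (G.Collider (p k) (p (k + 1)) (p (k + 2)) → p (k + 1) ∈ G.ancestors C) ∧
      (¬ G.Collider (p k) (p (k + 1)) (p (k + 2)) → p (k + 1) ∉ C)

/-- `A` and `B` are d-separated by `C` (to be used for pairwise disjoint `A`, `B`, `C`). -/
def DSep (A B C : Set W) : Prop :=
  ∀ a ∈ A, ∀ b ∈ B, ¬ G.ActiveTrail (Sum.inl '' C) (Sum.inl a) (Sum.inl b)

end HiddenDAG

/-! ### Distributions of the observed variables -/

section Distributions

variable {W : Type uW} [Fintype W] {S : W → Type uS} [∀ i, Fintype (S i)]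

open Classical in
/-- `P` is a probability mass function on the joint values of the observed variables. -/
def IsDistribution (P : (∀ i, S i) → ℝ) : Prop :=
  (∀ w, 0 ≤ P w) ∧ ∑ w, P w = 1

open Classical in
/-- The marginal probability `P(W_A = x)`. -/
noncomputable def marg (P : (∀ i, S i) → ℝ) (A : Set W) (x : ∀ j : A, S j) : ℝ :=
  ∑ w : ∀ i, S i, if ∀ j : A, w j = x j then P w else 0

open Classical in
/-- The conditional probability `P(W_i = s | W_A = x)`, meaningful when `P(W_A = x) ≠ 0`. -/
noncomputable def condProb (P : (∀ i, S i) → ℝ) (i : W) (A : Set W) (s : S i)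
    (x : ∀ j : A, S j) : ℝ :=
  (∑ w : ∀ i, S i, if w i = s ∧ ∀ j : A, w j = x j then P w else 0) / marg P A x

/-- `κ` is a version of the conditional distribution of `W_i` given `W_A`: a stochastic kernel
that equals the conditional probability wherever the latter is defined. -/
def IsCondDistribution (P : (∀ i, S i) → ℝ) (i : W) (A : Set W)
    (κ : S i → (∀ j : A, S j) → ℝ) : Prop :=
  (∀ s x, 0 ≤ κ s x) ∧ (∀ x, ∑ s, κ s x = 1) ∧
    ∀ s x, marg P A x ≠ 0 → κ s x = condProb P i A s x

/-- `W_A` and `W_B` are conditionally independent given `W_C` under `P`. -/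
def CondIndependent (P : (∀ i, S i) → ℝ) (A B C : Set W) : Prop :=
  ∀ w : ∀ i, S i,
    marg P (A ∪ B ∪ C) (fun j => w j) * marg P C (fun j => w j) =
      marg P (A ∪ C) (fun j => w j) * marg P (B ∪ C) (fun j => w j)

/-- `P` satisfies all conditional independencies among observed variables that are given by
d-separation in `G`. -/
def SatisfiesDSep {U : Type uU} (G : HiddenDAG W U) (P : (∀ i, S i) → ℝ) : Prop :=
  ∀ A B C : Set W, Disjoint A B → Disjoint A C → Disjoint B C →
    G.DSep A B C → CondIndependent P A B C

end Distributions

/-! ### The structural equations model and its marginal model -/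

/-- A nonparametric structural equations model over `G` with observed state spaces `S`: each
variable is a function of its parents and of its own error, and the errors are
independent. The state spaces of the unobserved variables and of the errors are arbitrary. -/
structure NPSEM {W : Type uW} {U : Type uU} (G : HiddenDAG W U) (S : W → Type uS)
    [∀ i, MeasurableSpace (S i)] where
  /-- The underlying probability space. -/
  Ω : Type v
  [mΩ : MeasurableSpace Ω]
  μ : Measure Ω
  [prob : IsProbabilityMeasure μ]
  /-- The state spaces of the unobserved variables. -/
  L : U → Type v
  [mL : ∀ u, MeasurableSpace (L u)]
  /-- The state spaces of the errors. -/
  E : W ⊕ U → Type v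
  [mE : ∀ x, MeasurableSpace (E x)]
  /-- The errors. -/
  err : ∀ x, Ω → E x
  measurable_err : ∀ x, Measurable (err x)
  indep_err : iIndepFun err μ
  /-- The structural functions of the observed variables. -/
  fW : ∀ i, (∀ j : G.obsPa (Sum.inl i), S j) × (∀ u : G.latPa (Sum.inl i), L u) × E (Sum.inl i) →
    S i
  measurable_fW : ∀ i, Measurable (fW i)
  /-- The structural functions of the unobserved variables. -/
  fU : ∀ u, (∀ j : G.obsPa (Sum.inr u), S j) × (∀ u' : G.latPa (Sum.inr u), L u') ×
    E (Sum.inr u) → L u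
  measurable_fU : ∀ u, Measurable (fU u)
  /-- The observed variables. -/
  obs : ∀ i, Ω → S i
  measurable_obs : ∀ i, Measurable (obs i)
  /-- The unobserved variables. -/
  lat : ∀ u, Ω → L u
  measurable_lat : ∀ u, Measurable (lat u)
  obs_eq : ∀ i ω, obs i ω =
    fW i (fun j => obs j ω, fun u => lat u ω, err (Sum.inl i) ω)
  lat_eq : ∀ u ω, lat u ω =
    fU u (fun j => obs j ω, fun u' => lat u' ω, err (Sum.inr u) ω)

attribute [instance] NPSEM.mΩ NPSEM.prob NPSEM.mL NPSEM.mE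

/-- The marginal model: all distributions of the observed variables that arise from a
structural equations model over `G`. -/
def marginalModel {W : Type uW} {U : Type uU} (G : HiddenDAG W U) (S : W → Type uS)
    [∀ i, MeasurableSpace (S i)] : Set ((∀ i, S i) → ℝ) :=
  {P | ∃ M : NPSEM.{uW, uU, uS, v} G S, ∀ w, P w = M.μ.real {ω | ∀ i, M.obs i ω = w i}}

/-! ### The constraints of a district -/

/-- A topological order of the observed vertices, given by a ranking. -/
def HiddenDAG.IsTopologicalOrder {W : Type uW} {U : Type uU} (G : HiddenDAG W U)
    (τ : W → ℕ) : Prop :=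
  Function.Injective τ ∧ ∀ i j, G.Edge (Sum.inl i) (Sum.inl j) → τ i < τ j

namespace HiddenDAG

variable {W : Type uW} {U : Type uU} (G : HiddenDAG W U)

/-- The district `D` (the variables `W₁`) with its observed parents outside `D` (the
variables `W₂`); a value of `W_{D ∪ pa(D)}` is a pair `(w₁, w₂)`. -/
def scope (D : Set W) : Set W := D ∪ G.obsPaSet D

/-- The members of `D ∪ pa(D)` that come before `i` in the order `τ`. -/
def before (τ : W → ℕ) (D : Set W) (i : W) : Set W := {j | j ∈ G.scope D ∧ τ j < τ i}

variable (S : W → Type uS)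

/-- The values of the response function variable of `i`: the maps from values of the observed
parents of `i` to values of `i`. -/
abbrev Response (i : W) : Type (max uW uS) := (∀ j : G.obsPa (Sum.inl i), S j) → S i

/-- The values of the response function variables of the members of `D`. -/
abbrev Responses (D : Set W) : Type (max uW uS) := ∀ i : D, G.Response S i

variable {S}

/-- The response functions `b` are compatible with the values `(w₁, w₂)`. -/
def Compatible {D : Set W} (b : G.Responses S D) (w : ∀ j : G.scope D, S j) : Prop :=
  ∀ i : D, b i (fun j => w ⟨j, Or.inr ⟨i, i.2, j.2⟩⟩) = w ⟨i, Or.inl i.2⟩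

open Classical in
/-- The vector `P*(W₁ = w₁ | W₂ = w₂)`: the product over the members `i` of the district `D` of
`P(W_i = w_i | W_A = w_A)`, where `A` consists of the members of `D ∪ pa(D)` before `i`. -/
noncomputable def pStar [Fintype W] (τ : W → ℕ) (D : Set W)
    (κ : ∀ i : D, S i → (∀ j : G.before τ D i, S j) → ℝ) : (∀ j : G.scope D, S j) → ℝ :=
  fun w => ∏ i : D, κ i (w ⟨i, Or.inl i.2⟩) (fun j => w ⟨j, j.2.1⟩)

variable (S)

open Classical in
/-- The 0-1 matrix `B` of the functional constraints `p = B r` of the district `D`. -/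
noncomputable def functionalMatrix (D : Set W) :
    Matrix (∀ j : G.scope D, S j) (G.Responses S D) ℝ :=
  Matrix.of fun w b => if G.Compatible b w then 1 else 0

/-- The matrix `B` with a row of ones added. -/
noncomputable def augmentedMatrix (D : Set W) :
    Matrix ((∀ j : G.scope D, S j) ⊕ Unit) (G.Responses S D) ℝ :=
  Matrix.fromRows (G.functionalMatrix S D) (Matrix.of fun _ _ => 1)

open Classical in
/-- The polyhedron given by the functional constraints of `D`: all vectors `p = B r` with `r` a
vector of probabilities of the response function variables. -/
def districtPolyhedron [Fintype W] [∀ i, Fintype (S i)] (D : Set W) :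
    Set ((∀ j : G.scope D, S j) → ℝ) :=
  {p | ∃ r : G.Responses S D → ℝ, (∀ b, 0 ≤ r b) ∧
    (G.augmentedMatrix S D).mulVec r = Sum.elim p (fun _ => 1)}

end HiddenDAG

/-- Two rational matrices and two rational vectors, for the system `H_i p ≤ b_i`,
`H_e p = b_e`. -/
structure HRep (n : Type*) where
  numIneq : ℕ
  numEq : ℕ
  Hi : Matrix (Fin numIneq) n ℚ
  bi : Fin numIneq → ℚ
  He : Matrix (Fin numEq) n ℚ
  be : Fin numEq → ℚ

open Classical in
/-- The real solutions of the system. -/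
def HRep.solutions {n : Type*} [Fintype n] (H : HRep n) : Set (n → ℝ) :=
  {p | (∀ k, ∑ x, (H.Hi k x : ℝ) * p x ≤ (H.bi k : ℝ)) ∧
    ∀ k, ∑ x, (H.He k x : ℝ) * p x = (H.be k : ℝ)}

open Classical in
/-- `H` is an H-representation of the polyhedron of the district `D`, that is, an output of the
V-to-H conversion of `p = B r`. -/
def IsDistrictHRep {W : Type uW} {U : Type uU} [Fintype W] (G : HiddenDAG W U)
    (S : W → Type uS) [∀ i, Fintype (S i)] (D : Set W) (H : HRep (∀ j : G.scope D, S j)) :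
    Prop :=
  H.solutions = G.districtPolyhedron S D

open Classical in
/-- `P` satisfies the constraints `H` on the vector `P*(W₁ = w₁ | W₂ = w₂)` of the district `D`.
The conditional probabilities in `P*` are read as a version of the conditional distributions;
there is only one where the conditioning events have positive probability. -/
def SatisfiesDistrict {W : Type uW} {U : Type uU} [Fintype W] (G : HiddenDAG W U)
    {S : W → Type uS} [∀ i, Fintype (S i)] (τ : W → ℕ) (D : Set W)
    (H : HRep (∀ j : G.scope D, S j)) (P : (∀ i, S i) → ℝ) : Prop :=
  ∃ κ : ∀ i : D, S i → (∀ j : G.before τ D i, S j) → ℝ,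
    (∀ i : D, IsCondDistribution P i (G.before τ D i) (κ i)) ∧
      G.pStar τ D κ ∈ H.solutions

/-!
The argument passes between distributions and *random response functions*. If every observed vertex
has at most one unobserved parent (`latentParentsUnique_of_cDegree`), then the districts are the
nonempty fibers of the map `block` that sends a vertex to its unobserved parent, or to itself if
there is none (`mem_districtOf_iff`). Since unobserved vertices have no parents, the response
functions of different blocks depend on disjoint sets of errors and are therefore independent.

*A distribution in the model satisfies the constraints.* The observed variables in an ancestral set
take the values `w` exactly if each response function maps the parent values in `w` to the value
in `w`. So the distribution of an ancestral set is a product of one factor per block, which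
involves only the ancestral part of the block and its parents (`marg_eq_prod_blockProb`).
* If `C` d-separates `A` and `B`, then the set of vertices reached from `A` by active trails
  contains all or none of the variables of such a factor outside `C` (`Reached.of_block_eq`).
  Hence the distribution of the ancestral closure of `A ∪ B ∪ C` factorizes along the separation, and the
  conditional independence follows by exchanging the coordinates on one side between two copies of
  the distribution (`condIndependent_of_factorization`).
* In the topological order, adding `i` to its predecessors changes only the factor of its own block,
  and the ratio depends on the predecessors in `D ∪ pa(D)` only. The ratio is thus a version of the
  conditional distribution in `P*`, and the product of the ratios over the district is the
  probability that the response functions of the district are compatible with `w`, which is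
  an entry of `B r` for the distribution `r` of these functions.

*A distribution that satisfies the constraints is in the model.* A vertex is d-separated from its
other predecessors by those in `D ∪ pa(D)` (`dSep_before`), so the chain rule gives `P` as the
product of the vectors `P*` over the districts, whatever versions are chosen. Each `P*` has the
form `B r`, and independent errors that carry response functions with the distributions `r` generate
`P` (`exists_npsem`): an unobserved vertex carries those of its children, and a vertex without
unobserved parent carries its own.

The H-representations come from Fourier–Motzkin elimination of `r` in the system
`p = B r, r ≥ 0, 1ᵀ r = 1` (`exists_linearSolutions_update`).
-/

/-! ### Marginals of distributions on a finite product -/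

section Marginals

variable {W : Type uW} [Fintype W] {S : W → Type uS} [∀ i, Fintype (S i)]

/-- `v` and `w` have the same coordinates in `A`. -/
def AgreeOn {W : Type uW} {S : W → Type uS} (A : Set W) (v w : ∀ i, S i) : Prop :=
  ∀ j ∈ A, v j = w j

open Classical in
theorem marg_eq_sum (P : (∀ i, S i) → ℝ) (A : Set W) (w : ∀ i, S i) :
    marg P A (fun j => w j) = ∑ v : ∀ i, S i, if AgreeOn A v w then P v else 0 := by
  unfold marg
  refine Finset.sum_congr rfl fun v _ => ?_
  have h : (∀ j : A, v j = w j) ↔ AgreeOn A v w := Subtype.forall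
  simp only [h]

open Classical in
theorem marg_nonneg {P : (∀ i, S i) → ℝ} (hP : ∀ w, 0 ≤ P w) (A : Set W) (x : ∀ j : A, S j) :
    0 ≤ marg P A x :=
  Finset.sum_nonneg fun w _ => by split_ifs <;> simp [hP]

open Classical in
theorem marg_anti {P : (∀ i, S i) → ℝ} (hP : ∀ w, 0 ≤ P w) {A B : Set W} (hAB : A ⊆ B)
    (w : ∀ i, S i) : marg P B (fun j => w j) ≤ marg P A (fun j => w j) := by
  rw [marg_eq_sum, marg_eq_sum]
  refine Finset.sum_le_sum fun v _ => ?_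
  by_cases h : AgreeOn B v w
  · rw [if_pos h, if_pos (show AgreeOn A v w from fun j hj => h j (hAB hj))]
  · rw [if_neg h]; split_ifs <;> simp [hP]

open Classical in
theorem marg_empty {P : (∀ i, S i) → ℝ} (hP : IsDistribution P) (w : ∀ i, S i) :
    marg P ∅ (fun j => w j) = 1 := by
  rw [marg_eq_sum]; simpa [AgreeOn] using hP.2

open Classical in
theorem marg_univ (P : (∀ i, S i) → ℝ) (w : ∀ i, S i) :
    marg P Set.univ (fun j => w j) = P w := by
  rw [marg_eq_sum, Finset.sum_eq_single w]
  · simp [AgreeOn]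
  · intro v _ hv
    rw [if_neg]
    exact fun h => hv (funext fun j => h j trivial)
  · simp

open Classical in
/-- The marginal of `W_A` is obtained from that of a larger `W_B`; the values of `W_B` are
represented by the `v` that take the fixed values `w₀` off `B`. -/
theorem marg_refine (P : (∀ i, S i) → ℝ) {A B : Set W} (hAB : A ⊆ B) (w w₀ : ∀ i, S i) :
    marg P A (fun j => w j) = ∑ v : ∀ i, S i,
      if AgreeOn A v w ∧ AgreeOn Bᶜ v w₀ then marg P B (fun j => v j) else 0 := by
  have h : ∀ v : ∀ i, S i, (if AgreeOn A v w ∧ AgreeOn Bᶜ v w₀ then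
      marg P B (fun j => v j) else 0) = ∑ u : ∀ i, S i,
      if (AgreeOn A v w ∧ AgreeOn Bᶜ v w₀) ∧ AgreeOn B u v then P u else 0 := by
    intro v
    rw [marg_eq_sum]
    by_cases h : AgreeOn A v w ∧ AgreeOn Bᶜ v w₀
    · rw [if_pos h]
      exact Finset.sum_congr rfl fun u _ => if_congr (by simp [h]) rfl rfl
    · rw [if_neg h]
      exact (Finset.sum_eq_zero fun u _ => if_neg fun h' => h h'.1).symm
  rw [Finset.sum_congr rfl fun v _ => h v, Finset.sum_comm, marg_eq_sum]
  refine Finset.sum_congr rfl fun u _ => ?_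
  rw [Finset.sum_eq_single (B.piecewise u w₀)]
  · refine if_congr ?_ rfl rfl
    constructor
    · intro h
      refine ⟨⟨fun j hj => ?_, fun j hj => ?_⟩, fun j hj => ?_⟩
      · rw [Set.piecewise_eq_of_mem _ _ _ (hAB hj)]; exact h j hj
      · exact Set.piecewise_eq_of_notMem _ _ _ hj
      · exact (Set.piecewise_eq_of_mem _ _ _ hj).symm
    · rintro ⟨⟨h1, -⟩, h2⟩ j hj
      rw [h2 j (hAB hj), h1 j hj]
  · intro v _ hv
    rw [if_neg]
    rintro ⟨⟨-, h1⟩, h2⟩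
    refine hv (funext fun j => ?_)
    by_cases hj : j ∈ B
    · rw [Set.piecewise_eq_of_mem _ _ _ hj, h2 j hj]
    · rw [Set.piecewise_eq_of_notMem _ _ _ hj, h1 j hj]
  · simp

open Classical in
/-- If the conditional probability of `W_i = w_i` given `W_B` takes the same value `c` at all
values of `W_B` that extend the value of `W_A`, then it also takes this value given `W_A`. -/
theorem marg_insert_of_forall (P : (∀ i, S i) → ℝ) {A B : Set W} (hAB : A ⊆ B) {i : W}
    (hi : i ∉ B) (w : ∀ i, S i) (c : ℝ)
    (h : ∀ v : ∀ i, S i, AgreeOn (insert i A) v w →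
      marg P (insert i B) (fun j => v j) = marg P B (fun j => v j) * c) :
    marg P (insert i A) (fun j => w j) = marg P A (fun j => w j) * c := by
  rw [marg_refine P hAB w w, marg_refine P (Set.insert_subset_insert hAB) w w, Finset.sum_mul]
  refine Finset.sum_congr rfl fun v _ => ?_
  rw [ite_mul, zero_mul]
  have key : AgreeOn (insert i A) v w ∧ AgreeOn (insert i B)ᶜ v w ↔
      AgreeOn A v w ∧ AgreeOn Bᶜ v w := by
    constructor
    · rintro ⟨h1, h2⟩
      refine ⟨fun j hj => h1 j (Set.mem_insert_of_mem _ hj), fun j hj => ?_⟩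
      by_cases hji : j = i
      · exact h1 j (by simp [hji])
      · exact h2 j (by simpa [hji] using hj)
    · rintro ⟨h1, h2⟩
      refine ⟨fun j hj => ?_, fun j hj => h2 j fun hB => hj (Set.mem_insert_of_mem _ hB)⟩
      rcases hj with rfl | hj
      · exact h2 j hi
      · exact h1 j hj
  by_cases hk : AgreeOn A v w ∧ AgreeOn Bᶜ v w
  · rw [if_pos hk, if_pos (key.2 hk)]
    exact h v (key.2 hk).1
  · rw [if_neg hk, if_neg (fun h' => hk (key.1 h'))]

open Classical in
theorem condProb_eq (P : (∀ i, S i) → ℝ) {i : W} {A : Set W} (hi : i ∉ A) (s : S i)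
    (w : ∀ i, S i) : condProb P i A s (fun j => w j) =
      marg P (insert i A) (fun j => Function.update w i s j) / marg P A (fun j => w j) := by
  unfold condProb
  rw [marg_eq_sum P (insert i A)]
  congr 1
  refine Finset.sum_congr rfl fun v _ => ?_
  have h : (v i = s ∧ ∀ j : A, v j = w j) ↔
      AgreeOn (insert i A) v (Function.update w i s) := by
    unfold AgreeOn
    rw [Set.forall_mem_insert]
    simp only [Function.update_self, Subtype.forall]
    refine and_congr_right fun _ => forall₂_congr fun j hj => ?_
    rw [Function.update_of_ne (ne_of_mem_of_not_mem hj hi)]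
  simp only [h]

open Classical in
/-- If the distribution of `W_Z` is a product of a factor that does not involve `W_Y` and a
factor that involves `W_Y` and `W_C` only, then the parts of `Z` outside and inside `Y` are
conditionally independent given `W_C`. -/
theorem condIndependent_of_factorization (P : (∀ i, S i) → ℝ) {A B C Y Z : Set W}
    (hZ : A ∪ B ∪ C ⊆ Z) (hA : Disjoint A Y) (hC : Disjoint C Y) (hB : B ⊆ Y)
    (F H : (∀ i, S i) → ℝ) (hFH : ∀ v, marg P Z (fun j => v j) = F v * H v)
    (hF : ∀ v v' : ∀ i, S i, AgreeOn Yᶜ v v' → F v = F v')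
    (hH : ∀ v v' : ∀ i, S i, AgreeOn (Y ∪ C) v v' → H v = H v') :
    CondIndependent P A B C := by
  intro w
  have hABZ : A ∪ C ⊆ Z := fun j hj => hZ (by rcases hj with h | h <;> simp [h])
  have hBCZ : B ∪ C ⊆ Z := fun j hj => hZ (by rcases hj with h | h <;> simp [h])
  have hCZ : C ⊆ Z := fun j hj => hZ (by simp [hj])
  rw [marg_refine P hZ w w, marg_refine P hCZ w w, marg_refine P hABZ w w,
    marg_refine P hBCZ w w, Fintype.sum_mul_sum, Fintype.sum_mul_sum, ← Fintype.sum_prod_type',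
    ← Fintype.sum_prod_type']
  -- The terms of the two double sums correspond under the exchange of the coordinates in `Y`.
  have hpY : ∀ (a b : ∀ i, S i), ∀ j ∈ Y, Y.piecewise a b j = a j :=
    fun a b j hj => Set.piecewise_eq_of_mem _ _ _ hj
  have hpN : ∀ (a b : ∀ i, S i), ∀ j ∉ Y, Y.piecewise a b j = b j :=
    fun a b j hj => Set.piecewise_eq_of_notMem _ _ _ hj
  let e : (∀ i, S i) × (∀ i, S i) → (∀ i, S i) × (∀ i, S i) :=
    fun q => (Y.piecewise q.2 q.1, Y.piecewise q.1 q.2)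
  have he : Function.Involutive e := by
    rintro ⟨a, b⟩
    refine Prod.ext (funext fun j => ?_) (funext fun j => ?_) <;>
      by_cases hj : j ∈ Y <;> simp [e, hj]
  let t : Set W → (∀ i, S i) → ℝ := fun A v =>
    if AgreeOn A v w ∧ AgreeOn Zᶜ v w then marg P Z (fun j => v j) else 0
  suffices key : ∀ v v', t (A ∪ B ∪ C) v * t C v' =
      t (A ∪ C) (Y.piecewise v' v) * t (B ∪ C) (Y.piecewise v v') from
    Fintype.sum_equiv he.toPerm _ _ fun q => key q.1 q.2
  intro v v'
  simp only [t]
  have hAn : ∀ j ∈ A, j ∉ Y := fun j hj hY => Set.disjoint_left.1 hA hj hY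
  have hCn : ∀ j ∈ C, j ∉ Y := fun j hj hY => Set.disjoint_left.1 hC hj hY
  by_cases hcond : (AgreeOn (A ∪ B ∪ C) v w ∧ AgreeOn Zᶜ v w) ∧
      (AgreeOn C v' w ∧ AgreeOn Zᶜ v' w)
  · obtain ⟨⟨h1, h2⟩, h3, h4⟩ := hcond
    rw [if_pos ⟨h1, h2⟩, if_pos ⟨h3, h4⟩, if_pos, if_pos]
    · rw [hFH, hFH, hFH, hFH, hF (Y.piecewise v' v) v (hpN _ _),
        hF (Y.piecewise v v') v' (hpN _ _), hH (Y.piecewise v' v) v', hH (Y.piecewise v v') v]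
      · ring
      all_goals
        rintro j (hj | hj)
        · exact hpY _ _ j hj
        · rw [hpN _ _ j (hCn j hj), h3 j hj, h1 j (Or.inr hj)]
    · refine ⟨fun j hj => ?_, fun j hj => ?_⟩
      · rcases hj with hj | hj
        · rw [hpY _ _ j (hB hj)]; exact h1 j (Or.inl (Or.inr hj))
        · rw [hpN _ _ j (hCn j hj)]; exact h3 j hj
      · by_cases hY : j ∈ Y
        · rw [hpY _ _ j hY]; exact h2 j hj
        · rw [hpN _ _ j hY]; exact h4 j hj
    · refine ⟨fun j hj => ?_, fun j hj => ?_⟩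
      · rcases hj with hj | hj
        · rw [hpN _ _ j (hAn j hj)]; exact h1 j (Or.inl (Or.inl hj))
        · rw [hpN _ _ j (hCn j hj)]; exact h1 j (Or.inr hj)
      · by_cases hY : j ∈ Y
        · rw [hpY _ _ j hY]; exact h4 j hj
        · rw [hpN _ _ j hY]; exact h2 j hj
  · have h0 : ((if AgreeOn (A ∪ B ∪ C) v w ∧ AgreeOn Zᶜ v w then
        marg P Z (fun j => v j) else 0) * if AgreeOn C v' w ∧ AgreeOn Zᶜ v' w then
        marg P Z (fun j => v' j) else 0) = 0 := by
      rw [not_and_or] at hcond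
      rcases hcond with h | h
      · rw [if_neg h, zero_mul]
      · rw [if_neg h, mul_zero]
    refine h0.trans ?_
    symm
    by_contra hne
    obtain ⟨hne1, hne2⟩ := mul_ne_zero_iff.1 hne
    obtain ⟨h1, h2⟩ := (ite_ne_right_iff.1 hne1).1
    obtain ⟨h3, h4⟩ := (ite_ne_right_iff.1 hne2).1
    refine hcond ⟨⟨?_, fun j hj => ?_⟩, fun j hj => ?_, fun j hj => ?_⟩
    · rintro j ((hj | hj) | hj)
      · rw [← h1 j (Or.inl hj), hpN _ _ j (hAn j hj)]
      · rw [← h3 j (Or.inl hj), hpY _ _ j (hB hj)]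
      · rw [← h1 j (Or.inr hj), hpN _ _ j (hCn j hj)]
    · by_cases hY : j ∈ Y
      · rw [← h4 j hj, hpY _ _ j hY]
      · rw [← h2 j hj, hpN _ _ j hY]
    · rw [← h3 j (Or.inr hj), hpN _ _ j (hCn j hj)]
    · by_cases hY : j ∈ Y
      · rw [← h2 j hj, hpY _ _ j hY]
      · rw [← h4 j hj, hpN _ _ j hY]

/-- A set function that is multiplied by `k i` whenever `i` is added to its predecessors in the
order `τ` takes the value `∏ i, k i` on the whole set. -/
theorem eq_prod_of_chain {τ : W → ℕ} (hτ : Function.Injective τ) {f : Set W → ℝ} {k : W → ℝ}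
    (h0 : f ∅ = 1) (h : ∀ i, f (insert i {j | τ j < τ i}) = f {j | τ j < τ i} * k i) :
    f Set.univ = ∏ i, k i := by
  classical
  have key : ∀ n, f {j | τ j < n} = ∏ i with τ i < n, k i := by
    intro n
    induction n with
    | zero => simpa using h0
    | succ n ih =>
      by_cases hn : ∃ i, τ i = n
      · obtain ⟨i, rfl⟩ := hn
        have e1 : {j | τ j < τ i + 1} = insert i {j | τ j < τ i} := by
          ext j
          simp only [Set.mem_ofPred_eq, Set.mem_insert_iff, Nat.lt_succ_iff_lt_or_eq]
          rw [or_comm, hτ.eq_iff]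
        have e2 : (Finset.univ.filter fun j => τ j < τ i + 1) =
            insert i (Finset.univ.filter fun j => τ j < τ i) := by
          ext j
          simp only [Finset.mem_filter, Finset.mem_univ, true_and, Finset.mem_insert,
            Nat.lt_succ_iff_lt_or_eq]
          rw [or_comm, hτ.eq_iff]
        rw [e1, h i, ih, e2, Finset.prod_insert (by simp), mul_comm]
      · have e : ∀ j, τ j < n + 1 ↔ τ j < n := fun j =>
          ⟨fun hj => lt_of_le_of_ne (Nat.le_of_lt_succ hj) fun hj' => hn ⟨j, hj'⟩,
            fun hj => by omega⟩
        simp only [e, ih]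
  obtain ⟨n, hn⟩ : ∃ n, ∀ i, τ i < n :=
    ⟨Finset.univ.sup τ + 1, fun i => Nat.lt_succ_of_le (Finset.le_sup (Finset.mem_univ i))⟩
  have := key n
  simp only [hn, Set.ofPred_true, Finset.filter_true] at this
  exact this

end Marginals

/-! ### Elimination of variables from systems of linear inequalities -/

section Elimination

variable {ι : Type*} [Fintype ι]

/-- The real solutions of a set of linear inequalities `∑ x, a x * p x ≤ b` with rational
coefficients, each given as the pair `(a, b)`. -/
def linearSolutions (T : Set ((ι → ℚ) × ℚ)) : Set (ι → ℝ) :=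
  {p | ∀ c ∈ T, ∑ x, (c.1 x : ℝ) * p x ≤ (c.2 : ℝ)}

/-- Finitely many lower bounds and finitely many upper bounds are met by a common number if each
lower bound is at most each upper bound. -/
theorem exists_between_bounds {α β : Type*} {I : Set α} {J : Set β} (hI : I.Finite)
    (hJ : J.Finite) (l : α → ℝ) (u : β → ℝ) (h : ∀ i ∈ I, ∀ j ∈ J, l i ≤ u j) :
    ∃ t, (∀ i ∈ I, l i ≤ t) ∧ ∀ j ∈ J, t ≤ u j := by
  rcases I.eq_empty_or_nonempty with rfl | hne
  · obtain ⟨t, ht⟩ := (hJ.image u).bddBelow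
    exact ⟨t, by simp, fun j hj => ht ⟨j, hj, rfl⟩⟩
  · obtain ⟨i, hi, hmax⟩ := hI.exists_maximalFor l I hne
    refine ⟨l i, fun i' hi' => ?_, fun j hj => h i hi j hj⟩
    rcases le_total (l i') (l i) with h' | h'
    · exact h'
    · exact hmax hi' h'

open Classical in
theorem sum_mul_update (a : ι → ℝ) (p : ι → ℝ) (x : ι) (t : ℝ) :
    ∑ y, a y * Function.update p x t y = ∑ y, a y * Function.update p x 0 y + a x * t := by
  rw [← Finset.add_sum_erase _ _ (Finset.mem_univ x),
    ← Finset.add_sum_erase Finset.univ (fun y => a y * Function.update p x 0 y)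
      (Finset.mem_univ x)]
  simp only [Function.update_self, mul_zero, zero_add]
  rw [add_comm]
  congr 1
  refine Finset.sum_congr rfl fun y hy => ?_
  rw [Function.update_of_ne (Finset.ne_of_mem_erase hy),
    Function.update_of_ne (Finset.ne_of_mem_erase hy)]

open Classical in
/-- One step of Fourier–Motzkin elimination: each inequality that bounds the coordinate `x` from
above is combined with each one that bounds it from below. -/
theorem exists_linearSolutions_update {T : Set ((ι → ℚ) × ℚ)} (hT : T.Finite) (x : ι) :
    ∃ T' : Set ((ι → ℚ) × ℚ), T'.Finite ∧
      linearSolutions T' = {p | ∃ t, Function.update p x t ∈ linearSolutions T} := by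
  let comb : (ι → ℚ) × ℚ → (ι → ℚ) × ℚ → (ι → ℚ) × ℚ :=
    fun c d => (fun y => c.1 x * d.1 y - d.1 x * c.1 y, c.1 x * d.2 - d.1 x * c.2)
  let pos : Set ((ι → ℚ) × ℚ) := {c ∈ T | 0 < c.1 x}
  let neg : Set ((ι → ℚ) × ℚ) := {c ∈ T | c.1 x < 0}
  have hpos : pos.Finite := hT.subset fun c hc => hc.1
  have hneg : neg.Finite := hT.subset fun c hc => hc.1
  refine ⟨{c ∈ T | c.1 x = 0} ∪ Set.image2 comb pos neg,
    (hT.subset fun c hc => hc.1).union (hpos.image2 _ hneg), ?_⟩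
  ext p
  -- `L c` is the left-hand side of the inequality `c` without the term of the coordinate `x`.
  let L : (ι → ℚ) × ℚ → ℝ := fun c => ∑ y, (c.1 y : ℝ) * Function.update p x 0 y
  have hL : ∀ (c : (ι → ℚ) × ℚ) t,
      ∑ y, (c.1 y : ℝ) * Function.update p x t y = L c + (c.1 x : ℝ) * t :=
    fun c t => sum_mul_update (fun y => (c.1 y : ℝ)) p x t
  have hLp : ∀ c : (ι → ℚ) × ℚ, ∑ y, (c.1 y : ℝ) * p y = L c + (c.1 x : ℝ) * p x := by
    intro c
    rw [← hL, Function.update_eq_self]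
  have hcomb : ∀ c d, ∑ y, ((comb c d).1 y : ℝ) * p y =
      (c.1 x : ℝ) * L d - (d.1 x : ℝ) * L c := by
    intro c d
    have : ∑ y, ((comb c d).1 y : ℝ) * p y =
        (c.1 x : ℝ) * ∑ y, (d.1 y : ℝ) * p y - (d.1 x : ℝ) * ∑ y, (c.1 y : ℝ) * p y := by
      rw [Finset.mul_sum, Finset.mul_sum, ← Finset.sum_sub_distrib]
      refine Finset.sum_congr rfl fun y _ => ?_
      simp only [comb]
      push_cast
      ring
    rw [this, hLp, hLp]
    ring
  simp only [linearSolutions, Set.mem_ofPred_eq]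
  constructor
  · intro h
    obtain ⟨t, ht1, ht2⟩ := exists_between_bounds hneg hpos
      (fun d => ((d.2 : ℝ) - L d) / (d.1 x : ℝ)) (fun c => ((c.2 : ℝ) - L c) / (c.1 x : ℝ)) (by
        intro d hd c hc
        have h1 := h (comb c d) (Or.inr ⟨c, hc, d, hd, rfl⟩)
        rw [hcomb] at h1
        have hd' : (d.1 x : ℝ) < 0 := by exact_mod_cast hd.2
        have hc' : (0 : ℝ) < (c.1 x : ℝ) := by exact_mod_cast hc.2
        simp only [comb] at h1
        push_cast at h1
        rw [div_le_iff_of_neg hd', div_mul_eq_mul_div, div_le_iff₀ hc']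
        linarith)
    refine ⟨t, fun c hc => ?_⟩
    rw [hL]
    rcases lt_trichotomy (c.1 x) 0 with hx | hx | hx
    · have := ht1 c ⟨hc, hx⟩
      have hx' : (c.1 x : ℝ) < 0 := by exact_mod_cast hx
      rw [div_le_iff_of_neg hx'] at this
      linarith
    · have := h c (Or.inl ⟨hc, hx⟩)
      rw [hLp] at this
      simpa [hx] using this
    · have := ht2 c ⟨hc, hx⟩
      have hx' : (0 : ℝ) < (c.1 x : ℝ) := by exact_mod_cast hx
      rw [le_div_iff₀ hx'] at this
      linarith
  · rintro ⟨t, ht⟩ c hc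
    rcases hc with ⟨hc, hx⟩ | ⟨c, hc, d, hd, rfl⟩
    · have := ht c hc
      rw [hL] at this
      rw [hLp]
      simpa [hx] using this
    · have h1 := ht c hc.1
      have h2 := ht d hd.1
      rw [hL] at h1 h2
      rw [hcomb]
      have hd' : (d.1 x : ℝ) < 0 := by exact_mod_cast hd.2
      have hc' : (0 : ℝ) < (c.1 x : ℝ) := by exact_mod_cast hc.2
      simp only [comb]
      push_cast
      nlinarith

open Classical in
/-- Elimination of the coordinates in `E`. The system that is left is still indexed by all
coordinates, but its solutions do not depend on those in `E`. -/
theorem exists_linearSolutions_agree {T : Set ((ι → ℚ) × ℚ)} (hT : T.Finite) (E : Finset ι) :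
    ∃ T' : Set ((ι → ℚ) × ℚ), T'.Finite ∧
      linearSolutions T' = {p | ∃ q ∈ linearSolutions T, ∀ x ∉ E, q x = p x} := by
  induction E using Finset.induction_on with
  | empty =>
    refine ⟨T, hT, Set.ext fun p => ⟨fun h => ⟨p, h, fun _ _ => rfl⟩, ?_⟩⟩
    rintro ⟨q, hq, h⟩
    rwa [← show q = p from funext fun x => h x (by simp)]
  | insert x E _ ih =>
    obtain ⟨T₁, hT₁, h₁⟩ := ih
    obtain ⟨T₂, hT₂, h₂⟩ := exists_linearSolutions_update hT₁ x
    refine ⟨T₂, hT₂, ?_⟩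
    rw [h₂, h₁]
    ext p
    constructor
    · rintro ⟨t, q, hq, h⟩
      refine ⟨q, hq, fun y hy => ?_⟩
      rw [Finset.mem_insert, not_or] at hy
      rw [h y hy.2, Function.update_of_ne hy.1]
    · rintro ⟨q, hq, h⟩
      refine ⟨q x, q, hq, fun y hy => ?_⟩
      by_cases hyx : y = x
      · subst hyx; simp
      · rw [Function.update_of_ne hyx, h y (by simp [hyx, hy])]

/-- A projection of the solutions of a finite system of rational inequalities has an
H-representation. -/
theorem exists_hRep_projection {m n : Type*} [Fintype m] [Fintype n]
    {T : Set ((n ⊕ m → ℚ) × ℚ)} (hT : T.Finite) :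
    ∃ H : HRep n, H.solutions = {p | ∃ r : m → ℝ, Sum.elim p r ∈ linearSolutions T} := by
  classical
  obtain ⟨T', hT', h⟩ := exists_linearSolutions_agree hT
    (Finset.univ.filter fun x : n ⊕ m => x.isRight)
  have : Fintype T' := hT'.fintype
  let e := Fintype.equivFin T'
  refine ⟨⟨Fintype.card T', 0, fun k x => (e.symm k).1.1 (Sum.inl x), fun k => (e.symm k).1.2,
    fun k => k.elim0, fun k => k.elim0⟩, ?_⟩
  ext p
  have h1 : (∃ r : m → ℝ, Sum.elim p r ∈ linearSolutions T) ↔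
      Sum.elim p 0 ∈ linearSolutions T' := by
    rw [h]
    constructor
    · rintro ⟨r, hr⟩
      exact ⟨_, hr, by simp⟩
    · rintro ⟨q, hq, h⟩
      refine ⟨fun y => q (Sum.inr y), ?_⟩
      have hqe : q = Sum.elim p fun y => q (Sum.inr y) := by
        ext (x | y)
        · exact h (Sum.inl x) (by simp)
        · simp
      rwa [← hqe]
  rw [Set.mem_ofPred_eq, h1]
  simp only [HRep.solutions, linearSolutions, Set.mem_ofPred_eq, Fintype.sum_sum_type,
    Sum.elim_inl, Sum.elim_inr, Pi.zero_apply, mul_zero, Finset.sum_const_zero, add_zero]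
  constructor
  · rintro ⟨h2, -⟩ c hc
    simpa using h2 (e ⟨c, hc⟩)
  · intro h2
    exact ⟨fun k => h2 _ (e.symm k).2, fun k => k.elim0⟩

theorem sum_single_neg_one_mul [DecidableEq ι] (a : ι) (q : ι → ℝ) :
    ∑ x, ((Pi.single a (-1) : ι → ℚ) x : ℝ) * q x = -q a := by
  rw [Finset.sum_eq_single a (fun x _ hx => by rw [Pi.single_eq_of_ne hx]; simp) (by simp)]
  simp

end Elimination

open Classical in
theorem mem_districtPolyhedron_iff {W : Type uW} {U : Type uU} [Fintype W] (G : HiddenDAG W U)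
    {S : W → Type uS} [∀ i, Fintype (S i)] (D : Set W) (p : (∀ j : G.scope D, S j) → ℝ) :
    p ∈ G.districtPolyhedron S D ↔ ∃ r : G.Responses S D → ℝ, (∀ b, 0 ≤ r b) ∧ ∑ b, r b = 1 ∧
      ∀ w, ∑ b, (if G.Compatible b w then r b else 0) = p w := by
  refine exists_congr fun r => and_congr_right fun _ => ?_
  rw [funext_iff, Sum.forall, and_comm]
  refine and_congr ?_ (forall_congr' fun w => ?_)
  · simp [HiddenDAG.augmentedMatrix, Matrix.mulVec, dotProduct]
  · simp [HiddenDAG.augmentedMatrix, HiddenDAG.functionalMatrix, Matrix.mulVec, dotProduct]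

open Classical in
theorem exists_isDistrictHRep {W : Type uW} {U : Type uU} [Fintype W] (G : HiddenDAG W U)
    (S : W → Type uS) [∀ i, Fintype (S i)] (D : Set W) :
    ∃ H : HRep (∀ j : G.scope D, S j), IsDistrictHRep G S D H := by
  let n := ∀ j : G.scope D, S j
  let m := G.Responses S D
  -- The constraints on `(p, r)`: nonnegativity of `r`, total mass one, and `p = B r`.
  let nn : m → (n ⊕ m → ℚ) × ℚ := fun b => (Sum.elim 0 (Pi.single b (-1)), 0)
  let tot : (n ⊕ m → ℚ) × ℚ := (Sum.elim 0 1, 1)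
  let row : n → (n ⊕ m → ℚ) × ℚ := fun w =>
    (Sum.elim (Pi.single w (-1)) fun b => if G.Compatible b w then 1 else 0, 0)
  let T : Set ((n ⊕ m → ℚ) × ℚ) :=
    Set.range nn ∪ {tot, -tot} ∪ (Set.range row ∪ Set.range fun w => -row w)
  have hT : T.Finite := ((Set.finite_range _).union (by simp)).union
    ((Set.finite_range _).union (Set.finite_range _))
  obtain ⟨H, hH⟩ := exists_hRep_projection hT
  refine ⟨H, ?_⟩
  unfold IsDistrictHRep
  rw [hH]
  ext p
  rw [Set.mem_ofPred_eq, mem_districtPolyhedron_iff]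
  refine exists_congr fun r => ?_
  have hneg : ∀ c : (n ⊕ m → ℚ) × ℚ, (∑ x, ((-c).1 x : ℝ) * Sum.elim p r x ≤ ((-c).2 : ℝ)) ↔
      (c.2 : ℝ) ≤ ∑ x, (c.1 x : ℝ) * Sum.elim p r x := by
    intro c
    simp only [Prod.fst_neg, Prod.snd_neg, Pi.neg_apply, Rat.cast_neg, neg_mul,
      Finset.sum_neg_distrib, neg_le_neg_iff]
  have hnn : ∀ b, (∑ x, ((nn b).1 x : ℝ) * Sum.elim p r x ≤ ((nn b).2 : ℝ)) ↔ 0 ≤ r b := by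
    intro b
    simp only [nn, Fintype.sum_sum_type, Sum.elim_inl, Sum.elim_inr, sum_single_neg_one_mul]
    simp
  have htot : ∑ x, (tot.1 x : ℝ) * Sum.elim p r x = ∑ b, r b := by
    simp [tot, Fintype.sum_sum_type]
  have hrow : ∀ w, ∑ x, ((row w).1 x : ℝ) * Sum.elim p r x =
      ∑ b, (if G.Compatible b w then r b else 0) - p w := by
    intro w
    simp only [row, Fintype.sum_sum_type, Sum.elim_inl, Sum.elim_inr, sum_single_neg_one_mul]
    simp only [apply_ite (Rat.cast : ℚ → ℝ), Rat.cast_one, Rat.cast_zero, ite_mul, one_mul,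
      zero_mul]
    ring
  constructor
  · intro h
    refine ⟨fun b => (hnn b).1 (h _ (Or.inl (Or.inl ⟨b, rfl⟩))), ?_, fun w => ?_⟩
    · have h1 := h tot (Or.inl (Or.inr (Or.inl rfl)))
      have h2 := (hneg tot).1 (h (-tot) (Or.inl (Or.inr (Or.inr rfl))))
      rw [htot] at h1 h2
      simp only [tot, Rat.cast_one] at h1 h2
      exact le_antisymm h1 h2
    · have h1 := h (row w) (Or.inr (Or.inl ⟨w, rfl⟩))
      have h2 := (hneg (row w)).1 (h (-row w) (Or.inr (Or.inr ⟨w, rfl⟩)))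
      rw [hrow] at h1 h2
      simp only [row, Rat.cast_zero] at h1 h2
      linarith
  · rintro ⟨h1, h2, h3⟩ c ((⟨b, rfl⟩ | rfl | rfl) | ⟨w, rfl⟩ | ⟨w, rfl⟩)
    · exact (hnn b).2 (h1 b)
    · rw [htot, h2]; simp [tot]
    · rw [hneg, htot, h2]; simp [tot]
    · rw [hrow, h3]; simp [row]
    · rw [hneg, hrow, h3]; simp [row]

/-! ### Districts when every observed vertex has at most one unobserved parent -/

namespace HiddenDAG

variable {W : Type uW} {U : Type uU} (G : HiddenDAG W U)

/-- Every observed vertex has at most one unobserved parent. -/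
def LatentParentsUnique : Prop :=
  ∀ (i : W) (u u' : U), G.Edge (Sum.inr u) (Sum.inl i) → G.Edge (Sum.inr u') (Sum.inl i) → u = u'

open Classical in
/-- The source of the randomness that `i` shares with its district: an unobserved parent of `i`
if there is one, else `i` itself. If unobserved parents are unique, the districts are the
nonempty fibers of this map. -/
noncomputable def block (i : W) : W ⊕ U :=
  if h : (G.latPa (Sum.inl i)).Nonempty then Sum.inr h.choose else Sum.inl i

variable {G}

theorem latentParentsUnique_of_cDegree [Finite W] [Finite U] (h : G.cDegree = 1) :
    G.LatentParentsUnique := by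
  intro i u u' hu hu'
  have hbdd : BddAbove (G.districtCDegree '' G.districts) :=
    ((Set.finite_range G.districtOf).image _).bddAbove
  have h1 : G.districtCDegree (G.districtOf i) ≤ 1 :=
    h ▸ le_csSup hbdd ⟨_, ⟨i, rfl⟩, rfl⟩
  have h2 : {u | ∃ j ∈ G.districtOf i, u ∈ G.latPa (Sum.inl j)}.ncard ≤ 1 :=
    (le_max_right _ _).trans h1
  exact (Set.ncard_le_one (Set.toFinite _)).1 h2 u
    ⟨i, SimpleGraph.Reachable.refl _, hu⟩ u' ⟨i, SimpleGraph.Reachable.refl _, hu'⟩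

theorem edge_of_block_eq_inr {i : W} {u : U} (h : G.block i = Sum.inr u) :
    G.Edge (Sum.inr u) (Sum.inl i) := by
  unfold block at h
  split_ifs at h with hne
  cases h
  exact hne.choose_spec

theorem eq_of_block_eq_inl {i k : W} (h : G.block i = Sum.inl k) : i = k := by
  unfold block at h
  split_ifs at h with hne
  cases h
  rfl

theorem block_eq_inr (hG : G.LatentParentsUnique) {i : W} {u : U}
    (h : G.Edge (Sum.inr u) (Sum.inl i)) : G.block i = Sum.inr u := by
  have hne : (G.latPa (Sum.inl i)).Nonempty := ⟨u, h⟩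
  unfold block
  rw [dif_pos hne]
  exact congrArg _ (hG i _ _ hne.choose_spec h)

theorem mem_districtOf_iff (hexo : G.LatentsExogenous) (hG : G.LatentParentsUnique) {i j : W} :
    j ∈ G.districtOf i ↔ G.block j = G.block i := by
  constructor
  · intro h
    let β : W ⊕ U → W ⊕ U := Sum.elim G.block Sum.inr
    have hstep : ∀ x y, G.Edge x y → (∃ u, x = Sum.inr u) → β x = β y := by
      rintro x (y | y) hxy ⟨u, rfl⟩
      · exact (block_eq_inr hG hxy).symm
      · exact absurd hxy (hexo _ _)
    have hwalk : ∀ {x y : W ⊕ U}, G.latentGraph.Walk x y → β x = β y := by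
      intro x y p
      induction p with
      | nil => rfl
      | cons hadj _ ih =>
        refine Eq.trans ?_ ih
        rcases (SimpleGraph.fromRel_adj _ _ _).1 hadj with ⟨-, ⟨hu, he⟩ | ⟨hu, he⟩⟩
        · exact hstep _ _ he hu
        · exact (hstep _ _ he hu).symm
    obtain ⟨p⟩ := h
    exact (hwalk p).symm
  · intro h
    rcases hx : G.block i with k | u
    · rw [hx] at h
      rw [eq_of_block_eq_inl hx, eq_of_block_eq_inl h]
      exact SimpleGraph.Reachable.refl _
    · rw [hx] at h
      have h1 : G.latentGraph.Adj (Sum.inr u) (Sum.inl i) :=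
        (SimpleGraph.fromRel_adj _ _ _).2 ⟨by simp, Or.inl ⟨⟨u, rfl⟩, edge_of_block_eq_inr hx⟩⟩
      have h2 : G.latentGraph.Adj (Sum.inr u) (Sum.inl j) :=
        (SimpleGraph.fromRel_adj _ _ _).2 ⟨by simp, Or.inl ⟨⟨u, rfl⟩, edge_of_block_eq_inr h⟩⟩
      exact h1.symm.reachable.trans h2.reachable

/-! ### Active trails -/

/-- There is an active trail given `C` that starts at `a` and whose last step goes from `x` to
`y`. -/
inductive ActiveStep (G : HiddenDAG W U) (C : Set (W ⊕ U)) (a : W ⊕ U) :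
    W ⊕ U → W ⊕ U → Prop
  | single {y : W ⊕ U} (h : G.Adj a y) : ActiveStep G C a a y
  | step {x y z : W ⊕ U} (h : ActiveStep G C a x y) (hyz : G.Adj y z)
      (hc : G.Collider x y z → y ∈ G.ancestors C) (hn : ¬ G.Collider x y z → y ∉ C) :
      ActiveStep G C a y z

theorem ActiveStep.activeTrail {C : Set (W ⊕ U)} {a x y : W ⊕ U} (h : G.ActiveStep C a x y) :
    G.ActiveTrail C a y := by
  suffices ∃ (n : ℕ) (p : ℕ → W ⊕ U), p 0 = a ∧ p n = x ∧ p (n + 1) = y ∧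
      (∀ k, k < n + 1 → G.Adj (p k) (p (k + 1))) ∧
      ∀ k, k + 1 < n + 1 →
        (G.Collider (p k) (p (k + 1)) (p (k + 2)) → p (k + 1) ∈ G.ancestors C) ∧
        (¬ G.Collider (p k) (p (k + 1)) (p (k + 2)) → p (k + 1) ∉ C) by
    obtain ⟨n, p, h0, -, hy, hadj, hin⟩ := this
    exact ⟨n + 1, p, h0, hy, hadj, hin⟩
  induction h with
  | @single y h =>
    refine ⟨0, fun k => if k = 0 then a else y, rfl, rfl, rfl, fun k hk => ?_, fun k hk => ?_⟩
    · obtain rfl : k = 0 := by omega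
      simpa using h
    · omega
  | @step x y z _ hyz hc hn ih =>
    obtain ⟨n, p, h0, hx, hy, hadj, hin⟩ := ih
    have hle : ∀ k, k ≤ n + 1 → (if k ≤ n + 1 then p k else z) = p k := fun k hk => if_pos hk
    have hlast : (if n + 1 + 1 ≤ n + 1 then p (n + 1 + 1) else z) = z := if_neg (by omega)
    refine ⟨n + 1, fun k => if k ≤ n + 1 then p k else z, ?_, ?_, hlast, fun k hk => ?_,
      fun k hk => ?_⟩
    · exact (hle 0 (by omega)).trans h0
    · exact (hle _ le_rfl).trans hy
    · rcases Nat.lt_succ_iff_lt_or_eq.1 hk with hk' | rfl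
      · simp only [hle k (by omega), hle (k + 1) (by omega)]
        exact hadj k hk'
      · simp only [hlast, hy, le_refl, if_true]
        exact hyz
    · rcases Nat.lt_succ_iff_lt_or_eq.1 hk with hk' | hk'
      · simp only [hle k (by omega), hle (k + 1) (by omega), hle (k + 2) (by omega)]
        exact hin k hk'
      · obtain rfl : k = n := by omega
        simp only [hlast, hx, hy, le_refl, if_true, Nat.le_succ]
        exact ⟨hc, hn⟩

theorem not_edge_of_edge {x y : W ⊕ U} (h : G.Edge x y) : ¬ G.Edge y x :=
  fun h' => G.acyclic x (.tail (.single h) h')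

theorem mem_ancestors_of_edge {C : Set (W ⊕ U)} {x y : W ⊕ U} (h : G.Edge x y)
    (hy : y ∈ G.ancestors C) : x ∈ G.ancestors C := by
  obtain ⟨c, hc, hyc⟩ := hy
  exact ⟨c, hc, .head h hyc⟩

theorem subset_ancestors (C : Set (W ⊕ U)) : C ⊆ G.ancestors C :=
  fun x hx => ⟨x, hx, .refl⟩

/-- A trail that climbs from `a` to an ancestor `x` of `a` is active if `x` is not an ancestor of
`C`; it arrives at `x` against the direction of its last edge. -/
theorem activeStep_of_ancestor {C : Set (W ⊕ U)} {a x : W ⊕ U}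
    (h : Relation.ReflTransGen G.Edge x a) (hx : x ∉ G.ancestors C) :
    x = a ∨ ∃ y, G.Edge x y ∧ G.ActiveStep C a y x := by
  induction h using Relation.ReflTransGen.head_induction_on with
  | refl => exact Or.inl rfl
  | @head x y hxy _ ih =>
    have hy : y ∉ G.ancestors C := fun hy => hx (mem_ancestors_of_edge hxy hy)
    refine Or.inr ⟨y, hxy, ?_⟩
    rcases ih hy with rfl | ⟨z, hyz, hz⟩
    · exact .single (Or.inr hxy)
    · exact .step hz (Or.inr hxy) (fun hc => absurd hc.1 (not_edge_of_edge hyz))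
        fun _ hyC => hy (subset_ancestors C hyC)

/-- An active trail to `x` can be prolonged by a directed path from `x` if `x` is not an ancestor
of `C`. -/
theorem ActiveStep.descend {C : Set (W ⊕ U)} {a x y z : W ⊕ U} (h : G.ActiveStep C a x y)
    (hyz : Relation.ReflTransGen G.Edge y z) (hy : y ∉ G.ancestors C) :
    G.ActiveTrail C a z := by
  induction hyz using Relation.ReflTransGen.head_induction_on generalizing x with
  | refl => exact h.activeTrail
  | @head y y' hyy' hy'z ih =>
    by_cases hy' : y' ∈ G.ancestors C
    · exact absurd (mem_ancestors_of_edge hyy' hy') hy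
    · exact ih (.step h (Or.inl hyy') (fun hc => absurd hc.2 (not_edge_of_edge hyy'))
        fun _ hyC => hy (subset_ancestors C hyC)) hy'

/-! ### The vertices reached by active trails -/

/-- `y` is in `A` or the end of an active trail given `C` that starts in `A`. -/
def Reached (G : HiddenDAG W U) (A C : Set (W ⊕ U)) (y : W ⊕ U) : Prop :=
  ∃ a ∈ A, y = a ∨ ∃ x, G.ActiveStep C a x y

theorem Reached.activeTrail {A C : Set (W ⊕ U)} {y : W ⊕ U} (h : G.Reached A C y) :
    ∃ a ∈ A, G.ActiveTrail C a y := by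
  obtain ⟨a, ha, rfl | ⟨x, hx⟩⟩ := h
  · exact ⟨y, ha, 0, fun _ => y, rfl, rfl, fun k hk => absurd hk (by omega),
      fun k hk => absurd hk (by omega)⟩
  · exact ⟨a, ha, hx.activeTrail⟩

section Separated

variable {A B C : Set (W ⊕ U)}

/-- If `A` and `B` are separated by `C`, then from a vertex outside `C` that is reached and an
ancestor of `A ∪ B ∪ C`, each step is possible: if it is not an ancestor of `C`, then the active
trail that climbs to it from `A` can be used in place of the given one, and if it is an ancestor
of `B`, then there would be an active trail from `A` to `B`. -/
theorem Reached.activeStep {x y : W ⊕ U} (hx : G.Reached A C x)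
    (hsep : ∀ a ∈ A, ∀ b ∈ B, ¬ G.ActiveTrail C a b)
    (hanc : x ∈ G.ancestors (A ∪ B ∪ C)) (hxC : x ∉ C) (hxy : G.Adj x y) :
    ∃ a ∈ A, G.ActiveStep C a x y := by
  by_cases hC : x ∈ G.ancestors C
  · obtain ⟨a, ha, rfl | ⟨z, hz⟩⟩ := hx
    · exact ⟨x, ha, .single hxy⟩
    · exact ⟨a, ha, .step hz hxy (fun _ => hC) fun _ => hxC⟩
  · obtain ⟨c, (hc | hc) | hc, hxc⟩ := hanc
    · refine ⟨c, hc, ?_⟩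
      rcases activeStep_of_ancestor hxc hC with rfl | ⟨z, hxz, hz⟩
      · exact .single hxy
      · exact .step hz hxy (fun h => absurd h.1 (not_edge_of_edge hxz)) fun _ => hxC
    · exfalso
      obtain ⟨a, ha, rfl | ⟨z, hz⟩⟩ := hx
      · rcases Relation.ReflTransGen.cases_head hxc with rfl | ⟨y', hxy', hy'c⟩
        · exact hsep x ha x hc ⟨0, fun _ => x, rfl, rfl, fun k hk => absurd hk (by omega),
            fun k hk => absurd hk (by omega)⟩
        · exact hsep x ha c hc (ActiveStep.descend (.single (Or.inl hxy')) hy'c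
            fun h => hC (mem_ancestors_of_edge hxy' h))
      · exact hsep a ha c hc (hz.descend hxc hC)
    · exact absurd ⟨c, hc, hxc⟩ hC

/-- With one member outside `C` of the family of a vertex `c` (the vertex and its parents), all
members of the family are reached. -/
theorem Reached.family {c x y : W ⊕ U} (hx : G.Reached A C x)
    (hsep : ∀ a ∈ A, ∀ b ∈ B, ¬ G.ActiveTrail C a b)
    (hc : c ∈ G.ancestors (A ∪ B ∪ C)) (hxC : x ∉ C) (hxc : x = c ∨ G.Edge x c)
    (hyc : y = c ∨ G.Edge y c) : G.Reached A C y := by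
  have hch : c ∉ C → G.Reached A C c → G.Reached A C y := by
    intro hcC hr
    rcases hyc with rfl | hyc
    · exact hr
    · obtain ⟨a, ha, h⟩ := hr.activeStep hsep hc hcC (Or.inr hyc)
      exact ⟨a, ha, Or.inr ⟨_, h⟩⟩
  rcases hxc with rfl | hxc
  · exact hch hxC hx
  · obtain ⟨a, ha, h⟩ := hx.activeStep hsep (mem_ancestors_of_edge hxc hc) hxC (Or.inl hxc)
    by_cases hcC : c ∈ C
    · rcases hyc with rfl | hyc
      · exact ⟨a, ha, Or.inr ⟨_, h⟩⟩
      · exact ⟨a, ha, Or.inr ⟨c, .step h (Or.inr hyc) (fun _ => subset_ancestors C hcC)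
          fun hn => absurd ⟨hxc, hyc⟩ hn⟩⟩
    · exact hch hcC ⟨a, ha, Or.inr ⟨_, h⟩⟩

end Separated

/-- If `C` separates `A` and `B`, then the ancestral part of a district, together with its
observed parents, lies on one side of the separation. -/
theorem Reached.of_block_eq {A B C : Set W} (hsep : G.DSep A B C) {i i' j j' : W}
    (hi : Sum.inl i ∈ G.ancestors (Sum.inl '' A ∪ Sum.inl '' B ∪ Sum.inl '' C))
    (hi' : Sum.inl i' ∈ G.ancestors (Sum.inl '' A ∪ Sum.inl '' B ∪ Sum.inl '' C))
    (hblock : G.block i = G.block i') (hj : j = i ∨ G.Edge (Sum.inl j) (Sum.inl i))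
    (hj' : j' = i' ∨ G.Edge (Sum.inl j') (Sum.inl i')) (hjC : j ∉ C)
    (h : G.Reached (Sum.inl '' A) (Sum.inl '' C) (Sum.inl j)) :
    G.Reached (Sum.inl '' A) (Sum.inl '' C) (Sum.inl j') := by
  have hsep' : ∀ a ∈ (Sum.inl '' A : Set (W ⊕ U)), ∀ b ∈ (Sum.inl '' B : Set (W ⊕ U)),
      ¬ G.ActiveTrail (Sum.inl '' C) a b := by
    rintro _ ⟨a, ha, rfl⟩ _ ⟨b, hb, rfl⟩
    exact hsep a ha b hb
  have hjC' : (Sum.inl j : W ⊕ U) ∉ Sum.inl '' C := by simpa using hjC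
  have hjf : (Sum.inl j : W ⊕ U) = Sum.inl i ∨ G.Edge (Sum.inl j) (Sum.inl i) := by simpa using hj
  have hjf' : (Sum.inl j' : W ⊕ U) = Sum.inl i' ∨ G.Edge (Sum.inl j') (Sum.inl i') := by
    simpa using hj'
  rcases hb : G.block i with k | u
  · obtain rfl : i = i' := (eq_of_block_eq_inl hb).trans (eq_of_block_eq_inl (hblock ▸ hb)).symm
    exact h.family hsep' hi hjC' hjf hjf'
  · have hu : G.Reached (Sum.inl '' A) (Sum.inl '' C) (Sum.inr u) :=
      h.family hsep' hi hjC' hjf (Or.inr (edge_of_block_eq_inr hb))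
    exact hu.family hsep' hi' (by simp) (Or.inr (edge_of_block_eq_inr (hblock ▸ hb))) hjf'

/-! ### The ordered local Markov property -/

theorem exists_le_of_reflTransGen {τ : W → ℕ} (hτ : G.IsTopologicalOrder τ)
    (hexo : G.LatentsExogenous) {x y : W ⊕ U} (h : Relation.ReflTransGen G.Edge x y) :
    ∀ i, x = Sum.inl i → ∃ j, y = Sum.inl j ∧ τ i ≤ τ j := by
  induction h with
  | refl => exact fun i hi => ⟨i, hi, le_rfl⟩
  | @tail y z _ hyz ih =>
    intro i hi
    obtain ⟨j, rfl, hj⟩ := ih i hi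
    rcases z with k | u
    · exact ⟨k, rfl, hj.trans (hτ.2 _ _ hyz).le⟩
    · exact absurd hyz (hexo _ _)

/-- Given its predecessors in its district and among the parents of the district, a vertex is
d-separated from its other predecessors. An active trail that leaves the vertex downwards cannot
return to a predecessor, for lack of a collider with a descendant in the conditioning set; one
that leaves it through an unobserved vertex of the district is stopped at the first predecessor
that it meets or at the parent that it meets next. -/
theorem dSep_before {τ : W → ℕ} (hτ : G.IsTopologicalOrder τ) (hexo : G.LatentsExogenous)
    (hG : G.LatentParentsUnique) {D : Set W} {i : W} (hD : ∀ j, j ∈ D ↔ G.block j = G.block i) :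
    G.DSep {i} ({j | τ j < τ i} \ G.before τ D i) (G.before τ D i) := by
  rintro a ha b ⟨hb, hbB⟩ ⟨n, p, h0, hn, hadj, hin⟩
  obtain rfl : a = i := ha
  have haD : a ∈ D := (hD a).2 rfl
  have hb : τ b < τ a := hb
  have hnotAnc : ∀ k : W, τ a ≤ τ k →
      (Sum.inl k : W ⊕ U) ∉ G.ancestors (Sum.inl '' G.before τ D a) := by
    rintro k hk ⟨_, ⟨c, hc, rfl⟩, hkc⟩
    obtain ⟨j, hj, hkj⟩ := exists_le_of_reflTransGen hτ hexo hkc k rfl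
    cases hj
    have hc' : τ c < τ a := hc.2
    omega
  -- The trail does not leave a vertex towards a parent in the conditioning set.
  have hpar : ∀ k l, k + 1 ≤ n → p (k + 1) = Sum.inl l → l ∈ G.before τ D a →
      ¬ G.Edge (p (k + 1)) (p k) := by
    intro k l hk hl hlB he
    rcases Nat.lt_or_ge (k + 1) n with hk' | hk'
    · refine (hin k hk').2 (fun hc => not_edge_of_edge he hc.1) ?_
      rw [hl]
      exact ⟨l, hlB, rfl⟩
    · obtain rfl : n = k + 1 := by omega
      rw [hl] at hn
      cases hn
      exact hbB hlB
  -- The possible states of the trail after `k` steps: it is at its start, or it has arrived along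
  -- an arrow at a vertex that is not a predecessor, or it is at an unobserved parent of the district.
  let good : ℕ → Prop := fun k => k = 0 ∨
    (∃ m j, k = m + 1 ∧ p k = Sum.inl j ∧ τ a ≤ τ j ∧ G.Edge (p m) (p k)) ∨
      ∃ u j, p k = Sum.inr u ∧ j ∈ D ∧ G.Edge (Sum.inr u) (Sum.inl j)
  have hend : ¬ good n := by
    rintro (rfl | ⟨m, j, rfl, hj, haj, -⟩ | ⟨u, j, hu, -⟩)
    · rw [h0] at hn
      cases hn
      exact lt_irrefl _ hb
    · rw [hj] at hn
      cases hn
      omega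
    · rw [hu] at hn
      cases hn
  have hstep : ∀ k, k < n → good k → ∃ k', k < k' ∧ k' ≤ n ∧ good k' := by
    rintro k hk (rfl | ⟨m, j, rfl, hj, haj, hm⟩ | ⟨u, j, hu, hjD, huj⟩)
    · refine ⟨1, one_pos, hk, ?_⟩
      rcases hadj 0 hk with he | he
      · rw [h0] at he
        rcases h1 : p (0 + 1) with l | u
        · rw [h1] at he
          refine Or.inr (Or.inl ⟨0, l, rfl, h1, (hτ.2 _ _ he).le, ?_⟩)
          change G.Edge (p 0) (p (0 + 1))
          rwa [h0, h1]
        · rw [h1] at he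
          exact absurd he (hexo _ _)
      · rcases h1 : p (0 + 1) with l | u
        · refine absurd he (hpar 0 l hk h1 ?_)
          rw [h0, h1] at he
          exact ⟨Or.inr ⟨a, haD, he⟩, hτ.2 _ _ he⟩
        · rw [h0, h1] at he
          exact Or.inr (Or.inr ⟨u, a, h1, haD, he⟩)
    · refine ⟨m + 2, by omega, hk, ?_⟩
      have hnc : ¬ G.Edge (p (m + 2)) (p (m + 1)) := fun he =>
        hnotAnc j haj (hj ▸ (hin m hk).1 ⟨hm, he⟩)
      have he := (hadj (m + 1) hk).resolve_right hnc
      have he' := he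
      rw [hj] at he'
      rcases h1 : p (m + 1 + 1) with l | u
      · rw [h1] at he'
        exact Or.inr (Or.inl ⟨m + 1, l, rfl, h1, haj.trans (hτ.2 _ _ he').le, he⟩)
      · rw [h1] at he'
        exact absurd he' (hexo _ _)
    · have he : G.Edge (p k) (p (k + 1)) :=
        (hadj k hk).resolve_right fun h => hexo u _ (hu ▸ h)
      rcases h1 : p (k + 1) with l | u'
      · have hul : G.Edge (Sum.inr u) (Sum.inl l) := by rwa [hu, h1] at he
        have hlD : l ∈ D := by
          rw [hD, block_eq_inr hG hul, ← block_eq_inr hG huj]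
          exact (hD j).1 hjD
        rcases Nat.lt_or_ge (τ l) (τ a) with hla | hla
        · have hlB : l ∈ G.before τ D a := ⟨Or.inl hlD, hla⟩
          have hkn : k + 1 < n := by
            refine lt_of_le_of_ne hk fun h => ?_
            rw [← h, h1] at hn
            cases hn
            exact hbB hlB
          have hcol : G.Edge (p (k + 2)) (p (k + 1)) := by
            by_contra hne
            refine (hin k hkn).2 (fun hc => hne hc.2) ?_
            rw [h1]
            exact ⟨l, hlB, rfl⟩
          rcases h2 : p (k + 2) with l' | u'
          · refine absurd hcol (hpar (k + 1) l' hkn h2 ?_)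
            rw [h1, h2] at hcol
            exact ⟨Or.inr ⟨l, hlD, hcol⟩, (hτ.2 _ _ hcol).trans hla⟩
          · rw [h1, h2] at hcol
            exact ⟨k + 2, by omega, hkn, Or.inr (Or.inr ⟨u', l, h2, hlD, hcol⟩)⟩
        · exact ⟨k + 1, by omega, hk, Or.inr (Or.inl ⟨k, l, rfl, h1, hla, he⟩)⟩
      · rw [h1] at he
        exact absurd he (hexo _ _)
  have hall : ∀ m k, k ≤ n → n - k = m → ¬ good k := by
    intro m
    induction m using Nat.strong_induction_on with
    | _ m ih =>
      intro k hk hm hg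
      rcases hk.lt_or_eq with hlt | rfl
      · obtain ⟨k', h1, h2, h3⟩ := hstep k hlt hg
        exact ih (n - k') (hm ▸ Nat.sub_lt_sub_left hlt h1) k' h2 rfl h3
      · exact hend hg
  exact hall n 0 (Nat.zero_le _) rfl (Or.inl rfl)

end HiddenDAG

/-! ### Independence of blocks -/

/-- Events that depend on disjoint blocks of a family of independent σ-algebras are
independent. -/
theorem measureReal_iInter_of_blocks {Ω ι K : Type*} [Fintype K] {m : ι → MeasurableSpace Ω}
    {m₀ : MeasurableSpace Ω} {μ : Measure Ω} [IsProbabilityMeasure μ] (hle : ∀ y, m y ≤ m₀)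
    (hind : iIndep m μ) (β : ι → K) (E : K → Set Ω)
    (hE : ∀ x, MeasurableSet[⨆ y ∈ β ⁻¹' {x}, m y] (E x)) :
    μ.real (⋂ x, E x) = ∏ x, μ.real (E x) := by
  classical
  suffices h : ∀ s : Finset K, μ.real (⋂ x ∈ s, E x) = ∏ x ∈ s, μ.real (E x) by
    simpa using h Finset.univ
  intro s
  induction s using Finset.induction_on with
  | empty => simp
  | insert x s hx ih =>
    have hdisj : Disjoint (β ⁻¹' {x}) (β ⁻¹' (s : Set K)) :=
      Disjoint.preimage _ (by simpa using hx)
    have hs : MeasurableSet[⨆ y ∈ β ⁻¹' (s : Set K), m y] (⋂ z ∈ s, E z) := by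
      refine Finset.measurableSet_biInter s fun z hz => ?_
      refine (?_ : (⨆ y ∈ β ⁻¹' {z}, m y) ≤ ⨆ y ∈ β ⁻¹' (s : Set K), m y) _ (hE z)
      exact biSup_mono fun y hy => by rw [Set.mem_preimage, Set.mem_singleton_iff.1 hy]; exact hz
    have h := (Indep_iff _ _ μ).1 (indep_iSup_of_disjoint hle hind hdisj) _ _ (hE x) hs
    rw [Finset.set_biInter_insert, Finset.prod_insert hx, ← ih, measureReal_def, h,
      ENNReal.toReal_mul]
    rfl

/-! ### The distribution of the observed variables of a structural equations model -/

/-- In a solution `v` of a recursive system, the values on an ancestral set `A` are `w` exactly if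
`w` solves the equations of `A`. -/
theorem HiddenDAG.agreeOn_iff_of_solution {W : Type uW} {U : Type uU} {G : HiddenDAG W U}
    {S : W → Type uS} {τ : W → ℕ} (hτ : G.IsTopologicalOrder τ)
    {F : ∀ i, G.Response S i} {v : ∀ i, S i} (hv : ∀ i, v i = F i fun j => v j) {A : Set W}
    (hA : ∀ i ∈ A, ∀ j, G.Edge (Sum.inl j) (Sum.inl i) → j ∈ A) (w : ∀ i, S i) :
    AgreeOn A v w ↔ ∀ i ∈ A, F i (fun j => w j) = w i := by
  constructor
  · intro h i hi
    rw [← h i hi, hv i]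
    congr 1
    funext j
    exact (h j (hA i hi j j.2)).symm
  · intro h
    have key : ∀ n i, τ i = n → i ∈ A → v i = w i := by
      intro n
      induction n using Nat.strong_induction_on with
      | _ n ih =>
        rintro i rfl hi
        rw [← h i hi, hv i]
        congr 1
        funext j
        exact ih (τ j) (hτ.2 _ _ j.2) j rfl (hA i hi j j.2)
    exact fun i hi => key _ i rfl hi

namespace NPSEM

variable {W : Type uW} {U : Type uU} {G : HiddenDAG W U} {S : W → Type uS}
  [∀ i, MeasurableSpace (S i)]

/-- The random response function of `i`: the structural function of `i` as a function of the
observed parents alone. -/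
def response (M : NPSEM.{uW, uU, uS, v} G S) (i : W) (ω : M.Ω) : G.Response S i :=
  fun p => M.fW i (p, fun u => M.lat u ω, M.err (Sum.inl i) ω)

/-- The probability that, at the values `w` of their parents, the response functions of the
members of `A` in the block `x` take the values `w`. -/
noncomputable def blockProb (M : NPSEM.{uW, uU, uS, v} G S) (x : W ⊕ U) (A : Set W)
    (w : ∀ i, S i) : ℝ :=
  M.μ.real {ω | ∀ i ∈ A, G.block i = x → M.response i ω (fun j => w j) = w i}

variable (M : NPSEM.{uW, uU, uS, v} G S)

theorem blockProb_nonneg (x : W ⊕ U) (A : Set W) (w : ∀ i, S i) : 0 ≤ M.blockProb x A w :=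
  measureReal_nonneg

theorem blockProb_anti (x : W ⊕ U) {A B : Set W} (hAB : A ⊆ B) (w : ∀ i, S i) :
    M.blockProb x B w ≤ M.blockProb x A w :=
  measureReal_mono fun _ h i hi => h i (hAB hi)

theorem blockProb_empty (x : W ⊕ U) (w : ∀ i, S i) : M.blockProb x ∅ w = 1 := by
  simp [blockProb]

theorem blockProb_insert_of_ne {x : W ⊕ U} {i : W} (hi : G.block i ≠ x) (A : Set W)
    (w : ∀ i, S i) : M.blockProb x (insert i A) w = M.blockProb x A w := by
  unfold blockProb
  congr 1
  ext ω
  exact Set.forall_mem_insert.trans (and_iff_right fun h => absurd h hi)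

theorem blockProb_congr {x : W ⊕ U} {A : Set W} {w w' : ∀ i, S i}
    (h : ∀ i ∈ A, G.block i = x → ∀ j, j = i ∨ G.Edge (Sum.inl j) (Sum.inl i) → w j = w' j) :
    M.blockProb x A w = M.blockProb x A w' := by
  unfold blockProb
  congr 1
  ext ω
  refine forall₃_congr fun i hi hx => ?_
  have hp : (fun j : G.obsPa (Sum.inl i) => w j) = fun j : G.obsPa (Sum.inl i) => w' j :=
    funext fun j => h i hi hx j (Or.inr j.2)
  rw [hp, h i hi hx i (Or.inl rfl)]

/-- The response function of `i` is a measurable function of the errors of the block of `i`. The map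
`φ` allows to apply this with a σ-algebra on `M.Ω` that is generated by these errors only. -/
theorem measurable_response_comp (hexo : G.LatentsExogenous) (hG : G.LatentParentsUnique)
    (i : W) (p : ∀ j : G.obsPa (Sum.inl i), S j) {α : Type*} [MeasurableSpace α] (φ : α → M.Ω)
    (hφ : ∀ y, Sum.elim G.block Sum.inr y = G.block i → Measurable fun a => M.err y (φ a)) :
    Measurable fun a => M.response i (φ a) p := by
  refine (M.measurable_fW i).comp (measurable_const.prodMk (Measurable.prodMk ?_ (hφ _ rfl)))
  refine measurable_pi_iff.2 fun u => ?_
  have hlat : (fun a => M.lat u (φ a)) = fun a => M.fU u (fun j => absurd j.2 (hexo _ _),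
      fun u' => absurd u'.2 (hexo _ _), M.err (Sum.inr u) (φ a)) := by
    funext a
    rw [M.lat_eq]
    congr 1
    refine Prod.ext (funext fun j => absurd j.2 (hexo _ _)) (Prod.ext ?_ rfl)
    exact funext fun u' => absurd u'.2 (hexo _ _)
  rw [hlat]
  exact (M.measurable_fU u).comp (measurable_const.prodMk (measurable_const.prodMk
    (hφ _ (HiddenDAG.block_eq_inr hG u.2).symm)))

theorem measurable_response (hexo : G.LatentsExogenous) (hG : G.LatentParentsUnique) (i : W) :
    Measurable (M.response i) :=
  measurable_pi_iff.2 fun p =>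
    M.measurable_response_comp hexo hG i p id fun y _ => M.measurable_err y

variable [∀ i, DiscreteMeasurableSpace (S i)]

/-- The response functions of different blocks are independent, since they depend on different
errors. -/
theorem measureReal_response_eq_prod [Fintype W] [Fintype U] (hexo : G.LatentsExogenous)
    (hG : G.LatentParentsUnique) (A : Set W) (w : ∀ i, S i) :
    M.μ.real {ω | ∀ i ∈ A, M.response i ω (fun j => w j) = w i} = ∏ x, M.blockProb x A w := by
  have h := measureReal_iInter_of_blocks (m := fun y => (M.mE y).comap (M.err y))
    (fun y => (M.measurable_err y).comap_le) (iIndepFun.iIndep M.indep_err)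
    (Sum.elim G.block Sum.inr)
    (fun x => {ω | ∀ i ∈ A, G.block i = x → M.response i ω (fun j => w j) = w i}) (by
      intro x
      have : {ω | ∀ i ∈ A, G.block i = x → M.response i ω (fun j => w j) = w i} =
          ⋂ i : {i // i ∈ A ∧ G.block i = x},
            (fun ω => M.response i ω fun j => w j) ⁻¹' {w i} := by
        ext ω
        simp
      rw [this]
      refine MeasurableSet.iInter fun i => ?_
      refine @measurableSet_preimage _ _ (_) _ _ _ ?_ (MeasurableSet.of_discrete)
      refine @measurable_response_comp _ _ _ _ _ M hexo hG i _ _ (_) id fun y hy => ?_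
      refine Measurable.of_comap_le ?_
      exact le_iSup₂_of_le y (by rw [Set.mem_preimage, hy, i.2.2]; rfl) le_rfl)
  unfold blockProb
  rw [← h]
  congr 1
  ext ω
  simp only [Set.mem_ofPred_eq, Set.mem_iInter]
  exact ⟨fun h x i hi _ => h i hi, fun h i hi => h _ i hi rfl⟩

variable [∀ i, Fintype (S i)]

/-- Summing over the value of the last vertex `i` removes it from the block: `i` is not a parent of
any of its predecessors. -/
theorem sum_blockProb_insert (hexo : G.LatentsExogenous) (hG : G.LatentParentsUnique) {τ : W → ℕ}
    (hτ : G.IsTopologicalOrder τ) (i : W) (w : ∀ i, S i) :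
    letI := Classical.decEq W
    ∑ s, M.blockProb (G.block i) (insert i {j | τ j < τ i}) (Function.update w i s) =
      M.blockProb (G.block i) {j | τ j < τ i} w := by
  classical
  have hm : Measurable fun ω => M.response i ω fun j => w j :=
    (measurable_pi_apply _).comp (M.measurable_response hexo hG i)
  let μ' := M.μ.restrict {ω | ∀ j ∈ {j | τ j < τ i}, G.block j = G.block i →
    M.response j ω (fun k => w k) = w j}
  have h := sum_measureReal_preimage_singleton (μ := μ') Finset.univ
    (f := fun ω => M.response i ω fun j => w j)
    (fun s _ => hm (measurableSet_singleton s))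
  rw [Finset.coe_univ, Set.preimage_univ, measureReal_restrict_apply_univ] at h
  refine Eq.trans (Finset.sum_congr rfl fun s _ => ?_) h
  rw [measureReal_restrict_apply (hm (measurableSet_singleton s))]
  unfold blockProb
  congr 1
  ext ω
  have hne : ∀ j, τ j < τ i → j ≠ i := fun j hj => by rintro rfl; exact lt_irrefl _ hj
  have hpar : ∀ j, τ j ≤ τ i → (fun k : G.obsPa (Sum.inl j) => Function.update w i s k) =
      fun k : G.obsPa (Sum.inl j) => w k := fun j hj => funext fun k =>
    Function.update_of_ne (hne k ((hτ.2 _ _ k.2).trans_le hj)) _ _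
  simp only [Set.mem_ofPred_eq, Set.mem_inter_iff, Set.mem_preimage, Set.mem_singleton_iff]
  rw [Set.forall_mem_insert]
  refine and_congr ?_ (forall₂_congr fun j hj => ?_)
  · rw [hpar i le_rfl, Function.update_self]
    simp
  · rw [hpar j (le_of_lt hj), Function.update_of_ne (hne j hj)]

variable [Fintype W] {P : (∀ i, S i) → ℝ}

theorem marg_eq_measureReal (hP : ∀ w, P w = M.μ.real {ω | ∀ i, M.obs i ω = w i}) (A : Set W)
    (w : ∀ i, S i) :
    marg P A (fun j => w j) = M.μ.real {ω | AgreeOn A (fun i => M.obs i ω) w} := by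
  classical
  have hm : Measurable fun ω i => M.obs i ω := measurable_pi_iff.2 M.measurable_obs
  have h := sum_measureReal_preimage_singleton (μ := M.μ)
    (Finset.univ.filter fun v : ∀ i, S i => AgreeOn A v w) (f := fun ω i => M.obs i ω)
    (fun v _ => hm (measurableSet_singleton v))
  rw [marg_eq_sum, ← Finset.sum_filter]
  refine Eq.trans ?_ (h.trans ?_)
  · refine Finset.sum_congr (by congr) fun v _ => ?_
    rw [hP]
    congr 1
    ext ω
    exact funext_iff.symm
  · congr 1
    ext ω
    simp

theorem isDistribution (hP : ∀ w, P w = M.μ.real {ω | ∀ i, M.obs i ω = w i}) :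
    IsDistribution P := by
  classical
  obtain ⟨ω₀⟩ := nonempty_of_isProbabilityMeasure M.μ
  refine ⟨fun w => hP w ▸ measureReal_nonneg, ?_⟩
  obtain ⟨w₀⟩ : Nonempty (∀ i, S i) := ⟨fun i => M.obs i ω₀⟩
  have h := marg_eq_measureReal M hP ∅ w₀
  rw [marg_eq_sum] at h
  simpa [AgreeOn] using h

variable [Fintype U]

theorem marg_eq_prod_blockProb (hexo : G.LatentsExogenous) (hG : G.LatentParentsUnique)
    {τ : W → ℕ} (hτ : G.IsTopologicalOrder τ)
    (hP : ∀ w, P w = M.μ.real {ω | ∀ i, M.obs i ω = w i}) {A : Set W}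
    (hA : ∀ i ∈ A, ∀ j, G.Edge (Sum.inl j) (Sum.inl i) → j ∈ A) (w : ∀ i, S i) :
    marg P A (fun j => w j) = ∏ x, M.blockProb x A w := by
  rw [marg_eq_measureReal M hP, ← measureReal_response_eq_prod M hexo hG]
  congr 1
  ext ω
  exact HiddenDAG.agreeOn_iff_of_solution hτ (F := fun i => M.response i ω)
    (fun i => M.obs_eq i ω) hA w

/-- The global Markov property. The distribution of an ancestral set is the product of the factors
of the blocks, and each factor involves variables on one side of the separation only. -/
theorem satisfiesDSep (hexo : G.LatentsExogenous) (hG : G.LatentParentsUnique)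
    {τ : W → ℕ} (hτ : G.IsTopologicalOrder τ)
    (hP : ∀ w, P w = M.μ.real {ω | ∀ i, M.obs i ω = w i}) : SatisfiesDSep G P := by
  classical
  intro A B C _ hAC hBC hsep
  let T : Set (W ⊕ U) := Sum.inl '' A ∪ Sum.inl '' B ∪ Sum.inl '' C
  let Z : Set W := {i | Sum.inl i ∈ G.ancestors T}
  let R : W → Prop := fun j => G.Reached (Sum.inl '' A) (Sum.inl '' C) (Sum.inl j)
  let Y : Set W := {j | j ∉ C ∧ ¬ R j}
  let good : W ⊕ U → Prop := fun x => ∃ i ∈ Z, G.block i = x ∧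
    ∃ j, (j = i ∨ G.Edge (Sum.inl j) (Sum.inl i)) ∧ j ∉ C ∧ R j
  refine condIndependent_of_factorization P (Z := Z) (Y := Y) ?_ ?_ ?_ ?_
    (fun v => ∏ x, if good x then M.blockProb x Z v else 1)
    (fun v => ∏ x, if good x then 1 else M.blockProb x Z v) ?_ ?_ ?_
  · rintro j ((hj | hj) | hj) <;> refine HiddenDAG.subset_ancestors T ?_
    · exact Or.inl (Or.inl ⟨j, hj, rfl⟩)
    · exact Or.inl (Or.inr ⟨j, hj, rfl⟩)
    · exact Or.inr ⟨j, hj, rfl⟩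
  · exact Set.disjoint_left.2 fun a ha hY => hY.2 ⟨Sum.inl a, ⟨a, ha, rfl⟩, Or.inl rfl⟩
  · exact Set.disjoint_left.2 fun c hc hY => hY.1 hc
  · intro b hb
    refine ⟨fun hC => Set.disjoint_left.1 hBC hb hC, fun hR => ?_⟩
    obtain ⟨_, ⟨a, ha, rfl⟩, h⟩ := hR.activeTrail
    exact hsep a ha b hb h
  · intro v
    rw [marg_eq_prod_blockProb M hexo hG hτ hP (A := Z)
      (fun i hi j hj => HiddenDAG.mem_ancestors_of_edge hj hi), ← Finset.prod_mul_distrib]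
    refine Finset.prod_congr rfl fun x _ => ?_
    split_ifs <;> simp
  · intro v v' h
    refine Finset.prod_congr rfl fun x _ => ?_
    split_ifs with hx
    · obtain ⟨i, hi, rfl, j, hj, hjC, hjR⟩ := hx
      refine M.blockProb_congr fun i' hi' hblock j' hj' => h j' fun hY => hY.2 ?_
      exact HiddenDAG.Reached.of_block_eq hsep hi hi' hblock.symm hj hj' hjC hjR
    · rfl
  · intro v v' h
    refine Finset.prod_congr rfl fun x _ => ?_
    split_ifs with hx
    · rfl
    · refine M.blockProb_congr fun i' hi' hblock j' hj' => h j' ?_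
      by_cases hC : j' ∈ C
      · exact Or.inr hC
      · exact Or.inl ⟨hC, fun hR => hx ⟨i', hi', hblock, j', hj', hC, hR⟩⟩

end NPSEM

/-! ### The district constraints hold in the marginal model -/

theorem HiddenDAG.mem_before_of_family {W : Type uW} {U : Type uU} {G : HiddenDAG W U} {τ : W → ℕ}
    (hτ : G.IsTopologicalOrder τ) {D : Set W} {i k j : W} (hk : k ∈ D) (hki : τ k ≤ τ i)
    (hj : j = k ∨ G.Edge (Sum.inl j) (Sum.inl k)) (hji : j ≠ i) : j ∈ G.before τ D i := by
  rcases hj with rfl | hj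
  · exact ⟨Or.inl hk, lt_of_le_of_ne hki fun h => hji (hτ.1 h)⟩
  · exact ⟨Or.inr ⟨k, hk, hj⟩, (hτ.2 _ _ hj).trans_le hki⟩

open Classical in
/-- The values `x` of the variables in `A`, completed by the values `w₀`. -/
noncomputable def extendBy {W : Type uW} {S : W → Type uS} (w₀ : ∀ i, S i) {A : Set W}
    (x : ∀ j : A, S j) : ∀ i, S i :=
  fun i => if h : i ∈ A then x ⟨i, h⟩ else w₀ i

theorem extendBy_apply {W : Type uW} {S : W → Type uS} (w₀ : ∀ i, S i) {A : Set W}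
    (x : ∀ j : A, S j) (j : A) : extendBy w₀ x j = x j :=
  dif_pos j.2

theorem extendBy_restrict {W : Type uW} {S : W → Type uS} (w₀ : ∀ i, S i) {A : Set W}
    (x : ∀ j : A, S j) : (fun j : A => extendBy w₀ x j) = x :=
  funext fun j => extendBy_apply w₀ x j

namespace NPSEM

variable {W : Type uW} {U : Type uU} {G : HiddenDAG W U} {S : W → Type uS}
  [∀ i, MeasurableSpace (S i)]

open Classical in
/-- The conditional distribution of `W_i` given `W_A` that is read off from the response functions
of the block of `i`. Where the response functions of the predecessors of `i` in the block exclude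
the given values, it is the point mass at `w₀ i`. -/
noncomputable def blockKernel (M : NPSEM.{uW, uU, uS, v} G S) (τ : W → ℕ) (w₀ : ∀ i, S i) (i : W)
    (A : Set W) (s : S i) (x : ∀ j : A, S j) : ℝ :=
  if M.blockProb (G.block i) {j | τ j < τ i} (extendBy w₀ x) = 0 then if s = w₀ i then 1 else 0
  else M.blockProb (G.block i) (insert i {j | τ j < τ i})
      (Function.update (extendBy w₀ x) i s) /
    M.blockProb (G.block i) {j | τ j < τ i} (extendBy w₀ x)

variable (M : NPSEM.{uW, uU, uS, v} G S) {τ : W → ℕ}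

theorem blockKernel_nonneg (w₀ : ∀ i, S i) (i : W) (A : Set W) (s : S i) (x : ∀ j : A, S j) :
    0 ≤ M.blockKernel τ w₀ i A s x := by
  unfold blockKernel
  split_ifs
  · exact zero_le_one
  · exact le_rfl
  · exact div_nonneg (M.blockProb_nonneg _ _ _) (M.blockProb_nonneg _ _ _)

theorem sum_blockKernel [∀ i, DiscreteMeasurableSpace (S i)] [∀ i, Fintype (S i)]
    (hexo : G.LatentsExogenous) (hG : G.LatentParentsUnique) (hτ : G.IsTopologicalOrder τ)
    (w₀ : ∀ i, S i) (i : W) (A : Set W) (x : ∀ j : A, S j) :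
    ∑ s, M.blockKernel τ w₀ i A s x = 1 := by
  classical
  unfold blockKernel
  by_cases h : M.blockProb (G.block i) {j | τ j < τ i} (extendBy w₀ x) = 0
  · simp only [if_pos h]
    simp
  · simp only [if_neg h]
    rw [← Finset.sum_div, div_eq_one_iff_eq h]
    convert M.sum_blockProb_insert hexo hG hτ i (extendBy w₀ x)

/-- The kernel is the factor by which the probability of the block changes when `i` is added to
its predecessors. -/
theorem blockProb_insert_eq (hτ : G.IsTopologicalOrder τ) {D : Set W} {i : W}
    (hD : ∀ j, j ∈ D ↔ G.block j = G.block i) (w₀ w : ∀ i, S i) :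
    M.blockProb (G.block i) (insert i {j | τ j < τ i}) w =
      M.blockProb (G.block i) {j | τ j < τ i} w *
        M.blockKernel τ w₀ i (G.before τ D i) (w i) (fun j => w j) := by
  classical
  set w' := extendBy w₀ (fun j : G.before τ D i => w j) with hw'
  have hag : ∀ j ∈ G.before τ D i, w j = w' j := fun j hj =>
    (extendBy_apply w₀ (fun j : G.before τ D i => w j) ⟨j, hj⟩).symm
  have h1 : M.blockProb (G.block i) {j | τ j < τ i} w =
      M.blockProb (G.block i) {j | τ j < τ i} w' := by
    refine M.blockProb_congr fun k hk hblock j hj => hag j ?_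
    have hk : τ k < τ i := hk
    refine HiddenDAG.mem_before_of_family hτ ((hD k).2 hblock) hk.le hj ?_
    rintro rfl
    rcases hj with rfl | hj
    · exact lt_irrefl _ hk
    · exact lt_asymm hk (hτ.2 _ _ hj)
  have h2 : M.blockProb (G.block i) (insert i {j | τ j < τ i}) w =
      M.blockProb (G.block i) (insert i {j | τ j < τ i}) (Function.update w' i (w i)) := by
    refine M.blockProb_congr fun k hk hblock j hj => ?_
    by_cases hji : j = i
    · subst hji
      rw [Function.update_self]
    · rw [Function.update_of_ne hji]
      have hki : τ k ≤ τ i := by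
        rcases hk with rfl | hk
        · exact le_rfl
        · exact le_of_lt hk
      exact hag j (HiddenDAG.mem_before_of_family hτ ((hD k).2 hblock) hki hj hji)
  unfold blockKernel
  by_cases h0 : M.blockProb (G.block i) {j | τ j < τ i} w = 0
  · rw [h0, zero_mul]
    exact le_antisymm (h0 ▸ M.blockProb_anti _ (Set.subset_insert _ _) _)
      (M.blockProb_nonneg _ _ _)
  · rw [← hw', if_neg (h1 ▸ h0), ← h1, ← h2, mul_div_cancel₀ _ h0]

/-- The product of the kernels telescopes to the probability that all response functions of the
block are compatible with `w`. -/
theorem pStar_blockKernel [Fintype W] (hτ : G.IsTopologicalOrder τ) {D : Set W} {x : W ⊕ U}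
    (hD : ∀ j, j ∈ D ↔ G.block j = x) (w₀ : ∀ i, S i) (w : ∀ i, S i) :
    G.pStar τ D (fun i => M.blockKernel τ w₀ i (G.before τ D i)) (fun j => w j) =
      M.blockProb x Set.univ w := by
  classical
  let k : W → ℝ := fun i =>
    if i ∈ D then M.blockKernel τ w₀ i (G.before τ D i) (w i) (fun j => w j) else 1
  have h := eq_prod_of_chain (f := fun A => M.blockProb x A w) (k := k) hτ.1
    (M.blockProb_empty x w) (fun i => by
      by_cases hi : i ∈ D
      · obtain rfl := (hD i).1 hi
        simp only [k, if_pos hi]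
        exact M.blockProb_insert_eq hτ hD w₀ w
      · simp only [k, if_neg hi, mul_one]
        exact M.blockProb_insert_of_ne (fun h => hi ((hD i).2 h)) _ _)
  refine Eq.trans ?_ h.symm
  rw [← Fintype.prod_subtype_mul_prod_subtype (· ∈ D)]
  have h1 : ∏ i : {i // i ∉ D}, k i = 1 :=
    Finset.prod_eq_one fun i _ => if_neg i.2
  rw [h1, mul_one]
  unfold HiddenDAG.pStar
  refine Finset.prod_congr (by congr!) fun i _ => ?_
  exact (if_pos i.2).symm

variable [∀ i, DiscreteMeasurableSpace (S i)] [∀ i, Fintype (S i)] [Fintype W]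

/-- The kernel is a version of the conditional distribution: when `i` is added to its predecessors,
only the factor of its own block changes. -/
theorem isCondDistribution_blockKernel [Fintype U] (hexo : G.LatentsExogenous)
    (hG : G.LatentParentsUnique) (hτ : G.IsTopologicalOrder τ) {P : (∀ i, S i) → ℝ}
    (hP : ∀ w, P w = M.μ.real {ω | ∀ i, M.obs i ω = w i}) {D : Set W} {i : W}
    (hD : ∀ j, j ∈ D ↔ G.block j = G.block i) (w₀ : ∀ i, S i) :
    IsCondDistribution P i (G.before τ D i) (M.blockKernel τ w₀ i (G.before τ D i)) := by
  classical
  refine ⟨M.blockKernel_nonneg w₀ i _, M.sum_blockKernel hexo hG hτ w₀ i _, fun s x hx => ?_⟩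
  set w := Function.update (extendBy w₀ x) i s with hw
  have hiB : i ∉ G.before τ D i := fun h => lt_irrefl _ h.2
  have hag : AgreeOn (G.before τ D i) (extendBy w₀ x) w := fun j hj =>
    (Function.update_of_ne (ne_of_mem_of_not_mem hj hiB) _ _).symm
  have hxw : x = fun j : G.before τ D i => w j := by
    rw [← extendBy_restrict w₀ x]
    exact funext fun j => hag j j.2
  have hcond := condProb_eq P hiB s (extendBy w₀ x)
  rw [extendBy_restrict] at hcond
  rw [hcond, eq_div_iff hx, mul_comm, ← show _ = marg P (insert i (G.before τ D i))
    (fun j => Function.update (extendBy w₀ x) i s j) by congr!]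
  symm
  rw [congrArg (marg P (G.before τ D i)) hxw]
  refine marg_insert_of_forall P (B := {j | τ j < τ i}) 
    (fun j (hj : j ∈ G.before τ D i) => hj.2) (lt_irrefl (τ i)) w _ fun v hv => ?_
  have hanc : ∀ k ∈ {j | τ j < τ i}, ∀ j, G.Edge (Sum.inl j) (Sum.inl k) → j ∈ {j | τ j < τ i} :=
    fun k hk j hj => lt_trans (hτ.2 _ _ hj) hk
  rw [marg_eq_prod_blockProb M hexo hG hτ hP hanc, marg_eq_prod_blockProb M hexo hG hτ hP,
    ← Finset.mul_prod_erase _ _ (Finset.mem_univ (G.block i)),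
    ← Finset.mul_prod_erase _ (fun z => M.blockProb z {j | τ j < τ i} v)
      (Finset.mem_univ (G.block i)), M.blockProb_insert_eq hτ hD w₀]
  · have hvi : v i = s := (hv i (Set.mem_insert _ _)).trans (Function.update_self _ _ _)
    have hvx : (fun j : G.before τ D i => v j) = x := by
      rw [hxw]
      exact funext fun j => hv j (Set.mem_insert_of_mem _ j.2)
    rw [hvi, hvx, Finset.prod_congr rfl fun z hz =>
      M.blockProb_insert_of_ne (Finset.ne_of_mem_erase hz).symm _ _]
    ring
  · rintro k (rfl | hk) j hj
    · exact Or.inr (hτ.2 _ _ hj)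
    · exact Or.inr (hanc k hk j hj)

theorem blockProb_univ_mem_districtPolyhedron (hexo : G.LatentsExogenous)
    (hG : G.LatentParentsUnique) {D : Set W} {x : W ⊕ U} (hD : ∀ j, j ∈ D ↔ G.block j = x)
    (w₀ : ∀ i, S i) :
    (fun w => M.blockProb x Set.univ (extendBy w₀ w)) ∈ G.districtPolyhedron S D := by
  classical
  let f : M.Ω → G.Responses S D := fun ω i => M.response i ω
  have hf : Measurable f := measurable_pi_iff.2 fun i => M.measurable_response hexo hG i
  refine (mem_districtPolyhedron_iff G D _).2
    ⟨fun b => M.μ.real (f ⁻¹' {b}), fun b => measureReal_nonneg, ?_, fun w => ?_⟩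
  · rw [sum_measureReal_preimage_singleton _ fun b _ => hf (measurableSet_singleton b)]
    simp
  · rw [← Finset.sum_filter,
      sum_measureReal_preimage_singleton _ fun b _ => hf (measurableSet_singleton b)]
    unfold blockProb
    congr 1
    ext ω
    simp only [Finset.coe_filter, Finset.mem_univ, true_and, Set.mem_preimage, Set.mem_ofPred_eq,
      Set.mem_univ, forall_true_left]
    refine Subtype.forall.trans (forall_congr' fun i => ?_)
    have h1 : ∀ hi : i ∈ D, (fun j : G.obsPa (Sum.inl i) => extendBy w₀ w j) =
        fun j : G.obsPa (Sum.inl i) => w ⟨j, Or.inr ⟨i, hi, j.2⟩⟩ := fun hi =>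
      funext fun j => extendBy_apply w₀ w ⟨j, Or.inr ⟨i, hi, j.2⟩⟩
    have h2 : ∀ hi : i ∈ D, extendBy w₀ w i = w ⟨i, Or.inl hi⟩ := fun hi =>
      extendBy_apply w₀ w ⟨i, Or.inl hi⟩
    constructor
    · intro h hx
      have hi := (hD i).2 hx
      rw [h1 hi, h2 hi]
      exact h hi
    · intro h hi
      have h' := h ((hD i).1 hi)
      rw [h1 hi, h2 hi] at h'
      exact h'

theorem satisfiesDistrict [Fintype U] (hexo : G.LatentsExogenous)
    (hG : G.LatentParentsUnique) (hτ : G.IsTopologicalOrder τ) {P : (∀ i, S i) → ℝ}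
    (hP : ∀ w, P w = M.μ.real {ω | ∀ i, M.obs i ω = w i}) {D : Set W} (hD : D ∈ G.districts)
    {H : HRep (∀ j : G.scope D, S j)} (hH : IsDistrictHRep G S D H) :
    SatisfiesDistrict G τ D H P := by
  obtain ⟨i₀, rfl⟩ := hD
  obtain ⟨ω₀⟩ := nonempty_of_isProbabilityMeasure M.μ
  let w₀ : ∀ i, S i := fun i => M.obs i ω₀
  have hD : ∀ j, j ∈ G.districtOf i₀ ↔ G.block j = G.block i₀ := fun j =>
    HiddenDAG.mem_districtOf_iff hexo hG
  refine ⟨fun i => M.blockKernel τ w₀ i _, fun i => ?_, ?_⟩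
  · refine M.isCondDistribution_blockKernel hexo hG hτ hP (fun j => ?_) w₀
    rw [hD, (hD i).1 i.2]
  · unfold IsDistrictHRep at hH
    rw [hH]
    convert M.blockProb_univ_mem_districtPolyhedron hexo hG hD w₀ using 1
    funext w
    rw [← M.pStar_blockKernel hτ hD w₀, extendBy_restrict]

end NPSEM

/-! ### Factorization of a distribution that satisfies the constraints -/

/-- The observed vertices in the block `x`: a district, or empty. -/
def HiddenDAG.blockSet {W : Type uW} {U : Type uU} (G : HiddenDAG W U) (x : W ⊕ U) : Set W :=
  {i | G.block i = x}

section Factorization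

variable {W : Type uW} {U : Type uU} [Fintype W] {G : HiddenDAG W U} {S : W → Type uS}
  [∀ i, Fintype (S i)] {τ : W → ℕ} {P : (∀ i, S i) → ℝ}

/-- The ordered local Markov property, in terms of a version of the conditional distribution. -/
theorem marg_insert_eq_mul (hexo : G.LatentsExogenous) (hG : G.LatentParentsUnique)
    (hτ : G.IsTopologicalOrder τ) (hP : IsDistribution P) (hsep : SatisfiesDSep G P) {D : Set W}
    {i : W} (hD : ∀ j, j ∈ D ↔ G.block j = G.block i)
    {κ : S i → (∀ j : G.before τ D i, S j) → ℝ} (hκ : IsCondDistribution P i (G.before τ D i) κ)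
    (w : ∀ i, S i) :
    marg P (insert i {j | τ j < τ i}) (fun j => w j) =
      marg P {j | τ j < τ i} (fun j => w j) * κ (w i) (fun j => w j) := by
  classical
  have hsub : G.before τ D i ⊆ {j | τ j < τ i} := fun j hj => hj.2
  have hiB : i ∉ G.before τ D i := fun h => lt_irrefl _ h.2
  by_cases h0 : marg P (G.before τ D i) (fun j => w j) = 0
  · have h1 : marg P {j | τ j < τ i} (fun j => w j) = 0 :=
      le_antisymm (h0 ▸ marg_anti hP.1 hsub w) (marg_nonneg hP.1 _ _)
    rw [h1, zero_mul]
    exact le_antisymm (h1 ▸ marg_anti hP.1 (Set.subset_insert _ _) w) (marg_nonneg hP.1 _ _)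
  · have hci := hsep {i} ({j | τ j < τ i} \ G.before τ D i) (G.before τ D i)
      (Set.disjoint_singleton_left.2 fun h => lt_irrefl (τ i) h.1)
      (Set.disjoint_singleton_left.2 hiB) Set.disjoint_sdiff_left
      (HiddenDAG.dSep_before hτ hexo hG hD) w
    rw [Set.union_assoc, Set.sdiff_union_of_subset hsub, Set.singleton_union,
      Set.singleton_union] at hci
    have hc := hκ.2.2 (w i) (fun j => w j) h0
    rw [condProb_eq P hiB (w i) w, Function.update_eq_self] at hc
    rw [hc, mul_div_assoc', eq_div_iff h0, hci, mul_comm]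

open Classical in
theorem pStar_mem_districtPolyhedron_of_isEmpty (D : Set W) [IsEmpty D]
    (κ : ∀ i : D, S i → (∀ j : G.before τ D i, S j) → ℝ) :
    G.pStar τ D κ ∈ G.districtPolyhedron S D := by
  rw [mem_districtPolyhedron_iff]
  refine ⟨fun _ => 1, fun _ => zero_le_one, ?_, fun w => ?_⟩
  · rw [Finset.sum_const, Finset.card_univ, Fintype.card_unique, one_smul]
  · have hc : G.Compatible (default : G.Responses S D) w := fun i => isEmptyElim i
    rw [Fintype.sum_unique, if_pos hc]
    exact (Finset.prod_of_isEmpty _).symm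

open Classical in
/-- A distribution that satisfies the constraints is a product over the blocks, each factor being
the probability that random response functions of the block are compatible with the values. -/
theorem exists_response_distributions [Fintype U] (hexo : G.LatentsExogenous)
    (hG : G.LatentParentsUnique) (hτ : G.IsTopologicalOrder τ) (hP : IsDistribution P)
    (hsep : SatisfiesDSep G P) {H : ∀ D : Set W, HRep (∀ j : G.scope D, S j)}
    (hH : ∀ D ∈ G.districts, IsDistrictHRep G S D (H D))
    (hdist : ∀ D ∈ G.districts, SatisfiesDistrict G τ D (H D) P) :
    ∃ r : ∀ x, G.Responses S (G.blockSet x) → ℝ, (∀ x b, 0 ≤ r x b) ∧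
      (∀ x, ∑ b, r x b = 1) ∧
      ∀ w, P w = ∏ x, ∑ b, if G.Compatible b (fun j => w j) then r x b else 0 := by
  have hblock : ∀ x : W ⊕ U, ∃ κ : ∀ i : G.blockSet x, S i →
      (∀ j : G.before τ (G.blockSet x) i, S j) → ℝ,
      (∀ i : G.blockSet x, IsCondDistribution P i (G.before τ (G.blockSet x) i) (κ i)) ∧
        G.pStar τ (G.blockSet x) κ ∈ G.districtPolyhedron S (G.blockSet x) := by
    intro x
    by_cases hne : ∃ i, G.block i = x
    · obtain ⟨i, rfl⟩ := hne
      have hD : G.blockSet (G.block i) = G.districtOf i :=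
        Set.ext fun j => (HiddenDAG.mem_districtOf_iff hexo hG).symm
      rw [hD]
      obtain ⟨κ, h1, h2⟩ := hdist _ ⟨i, rfl⟩
      refine ⟨κ, h1, ?_⟩
      have h3 := hH _ ⟨i, rfl⟩
      unfold IsDistrictHRep at h3
      rw [← h3]
      exact h2
    · have : IsEmpty (G.blockSet x) := ⟨fun i => hne ⟨i, i.2⟩⟩
      exact ⟨fun i => isEmptyElim i, fun i => isEmptyElim i,
        pStar_mem_districtPolyhedron_of_isEmpty _ _⟩
  choose κ hκ hpoly using hblock
  simp only [mem_districtPolyhedron_iff] at hpoly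
  choose r hr0 hr1 hr using hpoly
  refine ⟨r, hr0, hr1, fun w => ?_⟩
  have hchain := eq_prod_of_chain (f := fun A => marg P A fun j => w j)
    (k := fun i => κ (G.block i) ⟨i, rfl⟩ (w i) fun j => w j) hτ.1 (marg_empty hP w)
    fun i => marg_insert_eq_mul hexo hG hτ hP hsep (fun j => Iff.rfl) (hκ (G.block i) ⟨i, rfl⟩) w
  rw [marg_univ] at hchain
  rw [hchain, ← Fintype.prod_fiberwise G.block]
  refine Finset.prod_congr rfl fun x _ => ?_
  refine Eq.trans ?_ (hr x _).symm
  unfold HiddenDAG.pStar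
  refine @Fintype.prod_equiv _ _ _ (_) (_) _ (Equiv.refl _) _ _ fun i => ?_
  obtain ⟨i, rfl⟩ := i
  rfl

end Factorization

/-! ### A structural equations model with given distributions of response functions -/

theorem HiddenDAG.exists_solution {W : Type uW} {U : Type uU} {G : HiddenDAG W U}
    {S : W → Type uS} {τ : W → ℕ} (hτ : G.IsTopologicalOrder τ) (F : ∀ i, G.Response S i) :
    ∃ v : ∀ i, S i, ∀ i, v i = F i fun j => v j := by
  have wf : WellFounded fun i j : W => τ i < τ j := (measure τ).wf
  exact ⟨wf.fix fun i ih => F i fun j => ih j (hτ.2 _ _ j.2), fun i => wf.fix_eq _ i⟩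

section Construction

variable {W : Type uW} {U : Type uU} {G : HiddenDAG W U} {S : W → Type uS}

open Classical in
/-- The structural function of `i` when errors encode response functions: `i` applies the response
function that is encoded by its unobserved parent or, if there is none, by its own error. -/
noncomputable def responseEquation {E : W ⊕ U → Type v}
    (dec : ∀ x, E x → G.Responses S (G.blockSet x)) (i : W)
    (q : (∀ j : G.obsPa (Sum.inl i), S j) × (∀ u : G.latPa (Sum.inl i), E (Sum.inr u)) ×
      E (Sum.inl i)) : S i :=
  if h : (G.latPa (Sum.inl i)).Nonempty then
    dec (Sum.inr h.choose) (q.2.1 ⟨h.choose, h.choose_spec⟩) ⟨i, dif_pos h⟩ q.1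
  else dec (Sum.inl i) q.2.2 ⟨i, dif_neg h⟩ q.1

theorem responseEquation_eq {E : W ⊕ U → Type v}
    (dec : ∀ x, E x → G.Responses S (G.blockSet x)) (i : W)
    (p : ∀ j : G.obsPa (Sum.inl i), S j) (e : ∀ x, E x) :
    responseEquation dec i (p, fun u => e (Sum.inr u), e (Sum.inl i)) =
      dec (G.block i) (e (G.block i)) ⟨i, rfl⟩ p := by
  have h : ∀ x (hx : G.block i = x),
      dec x (e x) ⟨i, hx⟩ p = dec (G.block i) (e (G.block i)) ⟨i, rfl⟩ p := by
    rintro _ rfl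
    rfl
  unfold responseEquation
  split_ifs
  · exact h _ _
  · exact h _ _

variable [Fintype W] [Fintype U] [∀ i, Fintype (S i)] [∀ i, MeasurableSpace (S i)]
  [∀ i, DiscreteMeasurableSpace (S i)] {τ : W → ℕ}

/-- Independent errors that encode the response functions of the blocks give a structural
equations model in which the blocks contribute the probabilities of compatibility. -/
theorem exists_npsem (hτ : G.IsTopologicalOrder τ) {E : W ⊕ U → Type v} [∀ x, Finite (E x)]
    [∀ x, MeasurableSpace (E x)] [∀ x, DiscreteMeasurableSpace (E x)] (m : ∀ x, Measure (E x))
    [∀ x, IsProbabilityMeasure (m x)] (dec : ∀ x, E x → G.Responses S (G.blockSet x)) :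
    ∃ M : NPSEM.{uW, uU, uS, v} G S, ∀ w : ∀ i, S i,
      M.μ.real {ω | ∀ i, M.obs i ω = w i} =
        ∏ x, (m x).real {e | G.Compatible (dec x e) fun j => w j} := by
  -- The response functions that the errors `ω` assign to the observed variables
  let F : (∀ x, E x) → ∀ i, G.Response S i := fun ω i => dec (G.block i) (ω (G.block i)) ⟨i, rfl⟩
  choose obs hobs using fun ω => HiddenDAG.exists_solution hτ (F ω)
  -- The product space has too large a universe; `φ` encodes it by a finite space in universe `v`.
  obtain ⟨n, ⟨e⟩⟩ := Finite.exists_equiv_fin (∀ x, E x)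
  let Ω := ULift.{v} (Fin n)
  let φ : Ω ≃ ∀ x, E x := Equiv.ulift.trans e.symm
  have hφ : Measurable φ := measurable_of_finite _
  have hφs : Measurable φ.symm := measurable_of_finite _
  let μ : Measure Ω := (Measure.pi m).map φ.symm
  have : IsProbabilityMeasure μ := Measure.isProbabilityMeasure_map hφs.aemeasurable
  have hμ : ∀ s : Set (∀ x, E x), μ (φ ⁻¹' s) = Measure.pi m s := fun s => by
    rw [Measure.map_apply hφs (hφ (Set.toFinite s).measurableSet), ← Set.preimage_comp,
      Equiv.self_comp_symm, Set.preimage_id]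
  have hind : iIndepFun (fun x ω => φ ω x) μ := by
    rw [iIndepFun_iff_measure_inter_preimage_eq_mul]
    intro T sets hsets
    have h := (iIndepFun_iff_measure_inter_preimage_eq_mul.1
      (iIndepFun_pi (μ := m) (X := fun _ e => e) fun _ => aemeasurable_id)) T hsets
    have hinter : (⋂ x ∈ T, (fun ω => φ ω x) ⁻¹' sets x) =
        φ ⁻¹' ⋂ x ∈ T, (fun ω => ω x) ⁻¹' sets x := by
      simp only [Set.preimage_iInter]
      rfl
    rw [hinter, hμ, h]
    exact Finset.prod_congr rfl fun x _ => (hμ ((fun ω => ω x) ⁻¹' sets x)).symm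
  let M : NPSEM.{uW, uU, uS, v} G S :=
    { Ω := Ω
      μ := μ
      L := fun u => E (Sum.inr u)
      E := E
      err := fun x ω => φ ω x
      measurable_err := fun _ => measurable_of_finite _
      indep_err := hind
      fW := responseEquation dec
      measurable_fW := fun _ => measurable_of_finite _
      fU := fun _ q => q.2.2
      measurable_fU := fun _ => measurable_snd.comp measurable_snd
      obs := fun i ω => obs (φ ω) i
      measurable_obs := fun _ => measurable_of_finite _
      lat := fun u ω => φ ω (Sum.inr u)
      measurable_lat := fun _ => measurable_of_finite _
      obs_eq := fun i ω => (hobs (φ ω) i).trans (responseEquation_eq dec i _ (φ ω)).symm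
      lat_eq := fun _ _ => rfl }
  refine ⟨M, fun w => ?_⟩
  have hset : {ω | ∀ i, M.obs i ω = w i} =
      φ ⁻¹' Set.univ.pi fun x => {e | G.Compatible (dec x e) fun j => w j} := by
    ext ω
    have h := HiddenDAG.agreeOn_iff_of_solution hτ (hobs (φ ω)) (A := Set.univ)
      (fun _ _ _ _ => trivial) w
    simp only [AgreeOn, Set.mem_univ, forall_true_left] at h
    refine h.trans ?_
    simp only [Set.mem_preimage, Set.mem_pi, Set.mem_univ, forall_true_left]
    constructor
    · rintro h x ⟨i, rfl⟩
      exact h i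
    · exact fun h i => h (G.block i) ⟨i, rfl⟩
  rw [hset]
  change μ.real _ = _
  rw [measureReal_def, hμ, Measure.pi_pi, ENNReal.toReal_prod]
  rfl

end Construction

open Classical in
/-- Every distribution on a finite type is carried by a discrete probability space in any
universe. -/
theorem exists_encoding {R : Type*} [Fintype R] (r : R → ℝ) (h0 : ∀ b, 0 ≤ r b)
    (h1 : ∑ b, r b = 1) :
    ∃ (n : ℕ) (m : Measure (ULift.{v} (Fin n))) (dec : ULift.{v} (Fin n) → R),
      IsProbabilityMeasure m ∧ ∀ s : R → Prop,
        m.real {e | s (dec e)} = ∑ b, if s b then r b else 0 := by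
  let E := ULift.{v} (Fin (Fintype.card R))
  let dec : E ≃ R := Equiv.ulift.trans (Fintype.equivFin R).symm
  let q : PMF E := PMF.ofFintype (fun e => ENNReal.ofReal (r (dec e))) (by
    rw [← ENNReal.ofReal_sum_of_nonneg fun e _ => h0 _, Equiv.sum_comp dec r, h1,
      ENNReal.ofReal_one])
  refine ⟨_, q.toMeasure, dec, inferInstance, fun s => ?_⟩
  rw [measureReal_def, PMF.toMeasure_apply_fintype, ENNReal.toReal_sum]
  · rw [← Equiv.sum_comp dec]
    refine Finset.sum_congr rfl fun e _ => ?_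
    by_cases hs : s (dec e)
    · rw [if_pos hs, Set.indicator_of_mem (by exact hs), PMF.ofFintype_apply,
        ENNReal.toReal_ofReal (h0 _)]
    · rw [if_neg hs, Set.indicator_of_notMem (by exact hs), ENNReal.toReal_zero]
  · intro e _
    by_cases hs : s (dec e)
    · rw [Set.indicator_of_mem (by exact hs)]
      exact ENNReal.ofReal_ne_top
    · rw [Set.indicator_of_notMem (by exact hs)]
      exact ENNReal.zero_ne_top

theorem mem_marginalModel_of_constraints {W : Type uW} {U : Type uU} [Fintype W] [Fintype U]
    {G : HiddenDAG W U} (hexo : G.LatentsExogenous) (hG : G.LatentParentsUnique)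
    {S : W → Type uS} [∀ i, Fintype (S i)] [∀ i, MeasurableSpace (S i)]
    [∀ i, DiscreteMeasurableSpace (S i)] {τ : W → ℕ} (hτ : G.IsTopologicalOrder τ)
    {P : (∀ i, S i) → ℝ} (hP : IsDistribution P) (hsep : SatisfiesDSep G P)
    {H : ∀ D : Set W, HRep (∀ j : G.scope D, S j)}
    (hH : ∀ D ∈ G.districts, IsDistrictHRep G S D (H D))
    (hdist : ∀ D ∈ G.districts, SatisfiesDistrict G τ D (H D) P) :
    P ∈ marginalModel.{uW, uU, uS, v} G S := by
  classical
  obtain ⟨r, hr0, hr1, hr⟩ := exists_response_distributions hexo hG hτ hP hsep hH hdist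
  choose n m dec hm hdec using fun x => exists_encoding.{v} (r x) (hr0 x) (hr1 x)
  obtain ⟨M, hM⟩ := exists_npsem hτ m dec
  refine ⟨M, fun w => ?_⟩
  rw [hM, hr]
  exact Finset.prod_congr rfl fun x _ => (hdec x fun b => G.Compatible b fun j => w j).symm

theorem proposition3 {W : Type uW} {U : Type uU} [Fintype W] [Fintype U]
    (G : HiddenDAG W U) (h_exo : G.LatentsExogenous) (h_red : G.LatentsReduced)
    (h_deg : G.cDegree = 1)
    (S : W → Type uS) [∀ i, Fintype (S i)] [∀ i, MeasurableSpace (S i)]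
    [∀ i, DiscreteMeasurableSpace (S i)]
    (τ : W → ℕ) (hτ : G.IsTopologicalOrder τ) :
    (∀ D ∈ G.districts, ∃ H : HRep (∀ j : G.scope D, S j), IsDistrictHRep G S D H) ∧
    ∀ H : ∀ D : Set W, HRep (∀ j : G.scope D, S j),
      (∀ D ∈ G.districts, IsDistrictHRep G S D (H D)) →
      marginalModel.{uW, uU, uS, v} G S =
        {P | IsDistribution P ∧ SatisfiesDSep G P ∧
          ∀ D ∈ G.districts, SatisfiesDistrict G τ D (H D) P} := by
  have hG := HiddenDAG.latentParentsUnique_of_cDegree h_deg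
  refine ⟨fun D _ => exists_isDistrictHRep G S D, fun H hH => Set.ext fun P => ⟨?_, ?_⟩⟩
  · rintro ⟨M, hP⟩
    exact ⟨M.isDistribution hP, M.satisfiesDSep h_exo hG hτ hP,
      fun D hD => M.satisfiesDistrict h_exo hG hτ hP hD (hH D hD)⟩
  · rintro ⟨hP, hsep, hdist⟩
    exact mem_marginalModel_of_constraints h_exo hG hτ hP hsep hH hdist
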